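/- **Theorem 2 (underwater ridge).** Let $a>b>0$, $\xi>0$, $\psi\in\mathbb R$ with $(\xi^2+a)\sin^2\psi\neq\xi^2+b$. Consider the Hamiltonian system $\dot x=H_p$, $\dot p=-H_x$ on $\{(x,p)\in\mathbb R^2\times\mathbb R^2: p\ne0\}$ with $$H=\sqrt{p_{x_1}^2+p_{x_2}^2}\,\sqrt{\frac{x_1^2+b}{x_1^2+a}},\qquad x|_{t=0}=(-\xi,0),\quad p|_{t=0}=(\cos\psi,\sin\psi).$$ Put $$h^2=\mathfrak h=\frac{\xi^2+b}{(\xi^2+b)-(\xi^2+a)\sin^2\psi},\qquad \gamma=\sin\psi,\qquad \delta=\tfrac13\big((b-a)\mathfrak h+3a-2b\big),$$ $$\alpha=\tfrac43\big((b-a)^2\mathfrak h^2-(b-a)b\,\mathfrak h+b^2\big),\qquad \beta=\tfrac4{27}\big((b-a)\mathfrak h+b\big)\big((b-a)\mathfrak h-2b\big)\big(2(b-a)\mathfrak h-b\big),$$ where $h$ is the principal square root of $\mathfrak h$ ($h=i\sqrt{|\mathfrak h|}$ if $\mathfrak h<0$). Let $\sqrt{1-\mathfrak h^{-1}}$ and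 $\sqrt{\mathfrak h-1}$ denote the principal square roots if $\sin\psi\ge0$ and their negatives if $\sin\psi<0$; if $\sin\psi=0$ (so $\mathfrak h=1$), the quotient $\gamma/\sqrt{\mathfrak h-1}$ stands for $\sqrt{(\xi^2+b)/(\xi^2+a)}$. There is a period lattice with invariants $g_2=\alpha$, $g_3=\beta$. Let $\wp=\wp(\,\cdot\,;\alpha,\beta)$ and $\zeta=\zeta(\,\cdot\,;\alpha,\beta)$ be the Weierstrass functions of such a lattice $\Lambda$. There is $\mathfrak p_0\in\mathbb C\setminus\Lambda$ with $$\wp(\mathfrak p_0)=\xi^2-\delta+a\qquad\text{and}\qquad \operatorname{Re}\!\Big(\frac{\wp'(\mathfrak p_0)}{h}\Big)\cos\psi\le0,$$ and for every such $\mathfrak p_0$ the following holds. (i) There is exactly one continuous function $\mathfrak p:\mathbb R\to\mathbb C\setminus\Lambda$ with $\mathfrak p(0)=\mathfrak p_0$ and $$\frac th=\delta\,(\mathfrak p(t)-\mathfrak p_0)-\zeta(\mathfrak p(t))+\zeta(\mathfrak p_0)\qquad(t\in\mathbb R),$$ and there is exactly one differentiable function $r:\mathbb R\to\mathbb R$ with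 $r(0)=\xi$ and $r(t)^2=\wp(\mathfrak p(t))+\delta-a$ for all $t$; write $\sqrt{\wp(\mathfrak p)+\delta-a}$ for $r$. (ii) The Cauchy problem has a solution on all of $\mathbb R$, every solution on an open interval containing $0$ is a restriction of it, and it is given by $$x_1=-\sqrt{\wp(\mathfrak p)+\delta-a},\qquad x_2=\sqrt{1-\mathfrak h^{-1}}\;t+\sqrt{\mathfrak h-1}\,(b-a)(\mathfrak p-\mathfrak p_0),$$ $$p_{x_1}=-\frac12\,\frac{\gamma}{\sqrt{\mathfrak h-1}}\,\frac{\wp'(\mathfrak p)}{\wp(\mathfrak p)+\delta-a+b}\,\frac1{\sqrt{\wp(\mathfrak p)+\delta-a}},\qquad p_{x_2}=\gamma=\sin\psi,$$ the formula for $p_{x_1}$ being asserted at the times $t$ with $x_1(t)\neq0$. -/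

import Mathlib

noncomputable section

namespace Ridge

/-! ### The Weierstrass functions with given invariants -/

/-- `L` is a period lattice with invariants `g₂ = α`, `g₃ = β`; the functions `℘(·; α, β)` and
`ζ(·; α, β)` are the Weierstrass functions of this lattice. -/
def HasInvariants (L : PeriodPair) (α β : ℝ) : Prop :=
  L.g₂ = (α : ℂ) ∧ L.g₃ = (β : ℂ)

/-- The Weierstrass zeta function `1/z + ∑_{l ≠ 0} (1/(z-l) + 1/l + z/l²)` of the lattice of `L`.
(The summand with `l = 0` is `1/z`, since division by zero gives zero.) -/
def weierstrassZeta (L : PeriodPair) (z : ℂ) : ℂ :=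
  ∑' l : L.lattice, (1 / (z - l) + 1 / (l : ℂ) + z / (l : ℂ) ^ 2)

/-! ### The Hamiltonian system -/

/-- The depth `D(x₁, x₂)` of the water layer over the ridge. -/
def depth (a b x₁ _x₂ : ℝ) : ℝ := (x₁ ^ 2 + b) / (x₁ ^ 2 + a)

/-- The Hamiltonian `H = |p| √D(x)`. -/
def hamiltonian (a b x₁ x₂ p₁ p₂ : ℝ) : ℝ :=
  √(p₁ ^ 2 + p₂ ^ 2) * √(depth a b x₁ x₂)

/-- `(x₁, x₂, p₁, p₂)` solves `ẋ = ∂H/∂p`, `ṗ = -∂H/∂x` on the time set `I`. The momentum does not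
vanish, as `H` is differentiable only where `p ≠ 0`. -/
structure IsSolutionOn (a b : ℝ) (I : Set ℝ) (x₁ x₂ p₁ p₂ : ℝ → ℝ) : Prop where
  momentum_ne_zero : ∀ t ∈ I, ¬ (p₁ t = 0 ∧ p₂ t = 0)
  x₁_dot : ∀ t ∈ I,
    HasDerivAt x₁ (deriv (fun u => hamiltonian a b (x₁ t) (x₂ t) u (p₂ t)) (p₁ t)) t
  x₂_dot : ∀ t ∈ I,
    HasDerivAt x₂ (deriv (fun u => hamiltonian a b (x₁ t) (x₂ t) (p₁ t) u) (p₂ t)) t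
  p₁_dot : ∀ t ∈ I,
    HasDerivAt p₁ (-deriv (fun u => hamiltonian a b u (x₂ t) (p₁ t) (p₂ t)) (x₁ t)) t
  p₂_dot : ∀ t ∈ I,
    HasDerivAt p₂ (-deriv (fun u => hamiltonian a b (x₁ t) u (p₁ t) (p₂ t)) (x₂ t)) t

/-- The initial conditions `x = (-ξ, 0)`, `p = (cos ψ, sin ψ)` at `t = 0`. -/
def HasInitialData (ξ ψ : ℝ) (x₁ x₂ p₁ p₂ : ℝ → ℝ) : Prop :=
  x₁ 0 = -ξ ∧ x₂ 0 = 0 ∧ p₁ 0 = Real.cos ψ ∧ p₂ 0 = Real.sin ψ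

/-! ### The constants -/

/-- The constant `𝔥`. -/
def frakh (a b ξ ψ : ℝ) : ℝ :=
  (ξ ^ 2 + b) / ((ξ ^ 2 + b) - (ξ ^ 2 + a) * Real.sin ψ ^ 2)

/-- The principal complex square root of a real number (`i √|s|` for `s < 0`). -/
def csqrt (s : ℝ) : ℂ := Complex.sqrt (s : ℂ)

/-- The constant `h` with `h² = 𝔥` (principal root). -/
def h (a b ξ ψ : ℝ) : ℂ := csqrt (frakh a b ξ ψ)

/-- The constant `δ`. -/
def delta (a b ξ ψ : ℝ) : ℝ := 1 / 3 * ((b - a) * frakh a b ξ ψ + 3 * a - 2 * b)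

/-- The constant `α`. -/
def alpha (a b ξ ψ : ℝ) : ℝ :=
  4 / 3 * ((b - a) ^ 2 * frakh a b ξ ψ ^ 2 - (b - a) * b * frakh a b ξ ψ + b ^ 2)

/-- The constant `β`. -/
def beta (a b ξ ψ : ℝ) : ℝ :=
  4 / 27 * ((b - a) * frakh a b ξ ψ + b) * ((b - a) * frakh a b ξ ψ - 2 * b) *
    (2 * (b - a) * frakh a b ξ ψ - b)

/-- The common sign of the square roots `√(1 - 1/𝔥)` and `√(𝔥 - 1)`: the sign of `sin ψ`. -/
def rootSign (ψ : ℝ) : ℝ := if Real.sin ψ < 0 then -1 else 1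

/-- The coefficient `γ / √(𝔥 - 1)`, `γ = sin ψ`, of the first momentum; for `sin ψ = 0`, where
`𝔥 = 1`, it stands for its limit. -/
def momentumCoeff (a b ξ ψ : ℝ) : ℂ :=
  if Real.sin ψ = 0 then ((√((ξ ^ 2 + b) / (ξ ^ 2 + a)) : ℝ) : ℂ)
  else (Real.sin ψ : ℂ) / ((rootSign ψ : ℂ) * csqrt (frakh a b ξ ψ - 1))

/-! ### The transcendental equations -/

/-- `p₀` is a root of `℘(p₀) = ξ² - δ + a`, on the branch where `℘'(p₀)/h` (a real number) and
`cos ψ` have opposite signs. -/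
def IsInitialPhase (a b ξ ψ : ℝ) (L : PeriodPair) (p₀ : ℂ) : Prop :=
  p₀ ∉ L.lattice ∧
  L.weierstrassP p₀ = ((ξ ^ 2 - delta a b ξ ψ + a : ℝ) : ℂ) ∧
  (L.derivWeierstrassP p₀ / h a b ξ ψ).re * Real.cos ψ ≤ 0

/-- `p` is the continuous branch, with `p(0) = p₀`, of roots of
`t / h = δ (p - p₀) - ζ(p) + ζ(p₀)`. -/
structure IsPhase (a b ξ ψ : ℝ) (L : PeriodPair) (p₀ : ℂ) (p : ℝ → ℂ) : Prop where
  continuous : Continuous p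
  initial : p 0 = p₀
  notMem : ∀ t, p t ∉ L.lattice
  equation : ∀ t : ℝ, (t : ℂ) / h a b ξ ψ =
    (delta a b ξ ψ : ℂ) * (p t - p₀) - weierstrassZeta L (p t) + weierstrassZeta L p₀

/-- `r` is the differentiable branch of `t ↦ √(℘(p(t)) + δ - a)` that is `ξ` at `t = 0`. It is
the non-negative root up to the first time when the radicand vanishes, and changes sign there. -/
structure IsRootBranch (a b ξ ψ : ℝ) (L : PeriodPair) (p : ℝ → ℂ) (r : ℝ → ℝ) : Prop where
  differentiable : Differentiable ℝ r
  initial : r 0 = ξ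
  sq : ∀ t, (r t : ℂ) ^ 2 = L.weierstrassP (p t) + (delta a b ξ ψ : ℂ) - (a : ℂ)

end Ridge

end

/-! Since `H` does not depend on `x₂`, both `p₂ = sin ψ` and `|p|² D = E²`, with `E² = D(ξ)`, are
conserved. On this level set `ẋ₁ = p₁ D / E`, so `x = x₁` satisfies `ẋ² = D - κ D²` with `κ = sin² ψ
/ D(ξ) = 1 - 1/𝔥`. In the new time `dτ = dt / (x² + a)` the square `X = x²` satisfies `(dX/dτ)² =
(4/𝔥) X (X + b) (X - (b - a) 𝔥 + b)`. Putting `τ = h (𝔭 - 𝔭₀)` removes the factor `1/𝔥`, and the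
shift `X = ℘ + δ - a` removes the quadratic term, which leaves `℘'² = 4℘³ - α℘ - β`. From `dt = h
(x² + a) d𝔭 = h (℘ + δ) d𝔭` and `ζ' = -℘` comes the transcendental equation, and `ẋ₂ = sin ψ D / E`
with `D = 1 + (b - a)/(x² + a)` integrates to the formula for `x₂`.

No elliptic integral is inverted. The equation `ẍ = ½ (D - κ D²)'` has a globally Lipschitz right
side, hence a unique global solution; `phaseOf` is defined from it by an integral, on the line
through `𝔭₀` with direction `1/h`. That `℘` and `℘'` have the expected values along this curve is
uniqueness for an ODE (`weierstrassP_comp_eq`, `weierstrassP_phaseOf`); the sign condition on `𝔭₀`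
fixes the initial value of `℘'`.

The phase is unique because `z ↦ δ z - ζ(z)` has the derivative `δ + ℘ = x² + a ≠ 0` along it. The
root branch is unique because `x` has only simple zeros.

The lattice exists because the three roots of the cubic are distinct and every pair of invariants
with nonzero discriminant occurs (`exists_periodPair_of_discriminant_ne_zero`); `𝔭₀` exists because
`℘` is onto. -/

open Filter Topology

/-! ### The Weierstrass zeta function -/

namespace Ridge

/-- The three fractions combine to `z² / ((z - l) l²)`; the resulting cubic decay is summable over a
planar lattice. -/
lemma weierstrassZeta_summand_bound {r : ℝ} {z l : ℂ} (hz : ‖z‖ < r) (hl : 2 * r ≤ ‖l‖) :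
    ‖1 / (z - l) + 1 / l + z / l ^ 2‖ ≤ 2 * r ^ 2 * ‖l‖ ^ (-3 : ℝ) := by
  have hr : 0 < r := (norm_nonneg z).trans_lt hz
  have hl0 : 0 < ‖l‖ := by linarith
  have hne : l ≠ 0 := norm_pos_iff.mp hl0
  have hsub : ‖l‖ / 2 ≤ ‖z - l‖ := by
    rw [norm_sub_rev]
    exact le_trans (by linarith) (norm_sub_norm_le l z)
  have hne' : z - l ≠ 0 := norm_pos_iff.mp (by linarith)
  have heq : 1 / (z - l) + 1 / l + z / l ^ 2 = z ^ 2 / ((z - l) * l ^ 2) := by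
    field_simp
    ring
  calc ‖1 / (z - l) + 1 / l + z / l ^ 2‖ = ‖z‖ ^ 2 / (‖z - l‖ * ‖l‖ ^ 2) := by
        rw [heq]; simp
    _ ≤ r ^ 2 / (‖l‖ / 2 * ‖l‖ ^ 2) := by gcongr
    _ = 2 * r ^ 2 * (‖l‖ ^ 3)⁻¹ := by field_simp
    _ = _ := by norm_cast

lemma hasSumLocallyUniformly_weierstrassZeta (L : PeriodPair) :
    HasSumLocallyUniformly
      (fun (l : L.lattice) (z : ℂ) ↦ 1 / (z - l) + 1 / (l : ℂ) + z / (l : ℂ) ^ 2)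
      (weierstrassZeta L) := by
  refine L.hasSumLocallyUniformly_aux (u := fun r l ↦ 2 * r ^ 2 * ‖l‖ ^ (-3 : ℝ)) _
    (fun _ _ ↦ (ZLattice.summable_norm_rpow _ _ (by simp; norm_num)).mul_left _) fun r hr ↦
    Filter.eventually_atTop.mpr ⟨2 * r, ?_⟩
  rintro _ h s hs l rfl
  exact weierstrassZeta_summand_bound hs h

lemma hasDerivAt_weierstrassZeta_summand {z l : ℂ} (h : z - l ≠ 0) :
    HasDerivAt (fun w : ℂ ↦ 1 / (w - l) + 1 / l + w / l ^ 2)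
      (-(1 / (z - l) ^ 2 - 1 / l ^ 2)) z := by
  have h1 : HasDerivAt (fun w : ℂ ↦ w - l) 1 z := (hasDerivAt_id z).sub_const l
  have h2 := ((h1.fun_inv h).add_const (1 / l)).fun_add ((hasDerivAt_id' z).div_const (l ^ 2))
  simp only [one_div] at h2 ⊢
  refine h2.congr_deriv ?_
  rw [neg_div, one_div]
  ring

/-- `ζ' = -℘` away from the lattice. -/
lemma hasDerivAt_weierstrassZeta (L : PeriodPair) {z : ℂ} (hz : z ∉ L.lattice) :
    HasDerivAt (weierstrassZeta L) (-L.weierstrassP z) z := by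
  have hopen : IsOpen ((L.lattice : Set ℂ)ᶜ) := L.isClosed_lattice.isOpen_compl
  have hne : ∀ w ∈ ((L.lattice : Set ℂ)ᶜ), ∀ l : L.lattice, w - (l : ℂ) ≠ 0 := fun w hw l h ↦
    hw (by rw [sub_eq_zero.mp h]; exact l.2)
  have hd : ∀ s : Finset L.lattice, ∀ w ∈ ((L.lattice : Set ℂ)ᶜ),
      HasDerivAt (fun w ↦ ∑ l ∈ s, (1 / (w - (l : ℂ)) + 1 / (l : ℂ) + w / (l : ℂ) ^ 2))
        (∑ l ∈ s, -(1 / (w - (l : ℂ)) ^ 2 - 1 / (l : ℂ) ^ 2)) w := fun s w hw ↦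
    HasDerivAt.fun_sum fun l _ ↦ hasDerivAt_weierstrassZeta_summand (hne w hw l)
  refine hasDerivAt_of_tendstoLocallyUniformlyOn (l := atTop) (g := weierstrassZeta L)
    (g' := fun w ↦ -L.weierstrassP w) hopen ?_
    (.of_forall fun s w hw ↦ hd s w hw) (fun w _ ↦ ?_) hz
  · have := (hasSumLocallyUniformly_iff_tendstoLocallyUniformly.mp
      L.hasSumLocallyUniformly_weierstrassP).tendstoLocallyUniformlyOn (s := (L.lattice : Set ℂ)ᶜ)
    refine this.neg.congr fun s w _ ↦ ?_
    simp only [Pi.neg_apply, Finset.sum_neg_distrib]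
  · exact (hasSumLocallyUniformly_weierstrassZeta L).hasSum (x := w)

end Ridge

/-! ### Surjectivity of `℘` and its second derivative -/

namespace PeriodPair

variable (L : PeriodPair)

lemma hasDerivAt_weierstrassP {z : ℂ} (hz : z ∉ L.lattice) :
    HasDerivAt L.weierstrassP (L.derivWeierstrassP z) z := by
  rw [← L.deriv_weierstrassP]
  exact ((L.differentiableOn_weierstrassP z hz).differentiableAt
    (L.isClosed_lattice.isOpen_compl.mem_nhds hz)).hasDerivAt

lemma tendsto_weierstrassP_cobounded {l : ℂ} (hl : l ∈ L.lattice) :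
    Tendsto L.weierstrassP (𝓝[≠] l) (Bornology.cobounded ℂ) :=
  tendsto_cobounded_of_meromorphicOrderAt_neg (by
    rw [L.order_weierstrassP l hl]; exact compareOfLessAndEq_eq_lt.mp rfl)

/-- Away from `l`, points near `l` are not lattice points. -/
lemma eventually_notMem_lattice (l : ℂ) : ∀ᶠ z in 𝓝[≠] l, z ∉ L.lattice := by
  filter_upwards [nhdsWithin_le_nhds (L.compl_lattice_sdiff_singleton_mem_nhds l),
    self_mem_nhdsWithin] with z hz hne hmem
  exact hz ⟨hmem, hne⟩

/-- The reciprocal of `℘ - w`, with the value `0` at the poles of `℘`. -/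
noncomputable def invWeierstrassPSub (w z : ℂ) : ℂ :=
  open Classical in if z ∈ L.lattice then 0 else (L.weierstrassP z - w)⁻¹

/-- At a lattice point `℘` tends to infinity, so the reciprocal is continuous there and the
singularity is removable. -/
lemma differentiable_invWeierstrassPSub {w : ℂ}
    (hw : ∀ z, z ∉ L.lattice → L.weierstrassP z ≠ w) :
    Differentiable ℂ (L.invWeierstrassPSub w) := by
  have hoff : ∀ z, z ∉ L.lattice → DifferentiableAt ℂ (L.invWeierstrassPSub w) z := by
    intro z hz
    refine (((L.hasDerivAt_weierstrassP hz).differentiableAt.sub_const w).inv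
      (sub_ne_zero.mpr (hw z hz))).congr_of_eventuallyEq ?_
    filter_upwards [L.isClosed_lattice.isOpen_compl.mem_nhds hz] with y hy
    exact if_neg hy
  intro z
  by_cases hz : z ∈ L.lattice
  · refine (Complex.analyticAt_of_differentiable_on_punctured_nhds_of_continuousAt
      ((L.eventually_notMem_lattice z).mono hoff) ?_).differentiableAt
    rw [continuousAt_iff_punctured_nhds, show L.invWeierstrassPSub w z = 0 from if_pos hz]
    refine ((tendsto_inv₀_cobounded (α := ℂ)).comp (tendsto_sub_const_cobounded w |>.comp
      (L.tendsto_weierstrassP_cobounded hz))).congr' ?_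
    filter_upwards [L.eventually_notMem_lattice z] with y hy
    exact (if_neg hy).symm
  · exact hoff z hz

/-- `℘` takes every complex value. -/
lemma exists_weierstrassP_eq (w : ℂ) : ∃ z, z ∉ L.lattice ∧ L.weierstrassP z = w := by
  by_contra! hw
  have hd := L.differentiable_invWeierstrassPSub hw
  have hper : ∀ z l, l ∈ L.lattice →
      L.invWeierstrassPSub w (z + l) = L.invWeierstrassPSub w z := by
    intro z l hl
    lift l to L.lattice using hl
    have : z + (l : ℂ) ∈ L.lattice ↔ z ∈ L.lattice :=
      L.lattice.toAddSubgroup.add_mem_cancel_right l.2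
    by_cases hz : z ∈ L.lattice
    · rw [invWeierstrassPSub, invWeierstrassPSub, if_pos hz, if_pos (this.mpr hz)]
    · rw [invWeierstrassPSub, invWeierstrassPSub, if_neg hz, if_neg (mt this.mp hz),
        L.weierstrassP_add_coe]
  -- Liouville: an entire doubly periodic function is constant, but this one is zero at `0` and
  -- nonzero at the half period.
  have hb := (IsZLattice.isCompact_range_of_periodic L.lattice _ hd.continuous hper).isBounded
  have h0 := hd.apply_eq_apply_of_bounded hb (L.ω₁ / 2) 0
  rw [invWeierstrassPSub, invWeierstrassPSub, if_neg L.ω₁_div_two_notMem_lattice,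
    if_pos L.lattice.zero_mem, inv_eq_zero, sub_eq_zero] at h0
  exact hw _ L.ω₁_div_two_notMem_lattice h0

/-- The complement of the lattice is connected, so by the identity theorem `℘` would be constant,
although it takes every value. -/
lemma not_eventually_derivWeierstrassP_eq_zero {z : ℂ} (hz : z ∉ L.lattice) :
    ¬ ∀ᶠ w in 𝓝 z, L.derivWeierstrassP w = 0 := by
  intro h
  have hconn : IsPreconnected ((L.lattice : Set ℂ)ᶜ) :=
    (Set.Countable.isConnected_compl_of_one_lt_rank (by simp) (Set.countable_coe_iff.mp
      (L.latticeEquivProd.toEquiv.countable_iff.mpr inferInstance))).isPreconnected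
  have hzero := L.analyticOnNhd_derivWeierstrassP.eqOn_zero_of_preconnected_of_eventuallyEq_zero
    hconn hz h
  have hopen : IsOpen ((L.lattice : Set ℂ)ᶜ) := L.isClosed_lattice.isOpen_compl
  have hconst : ∀ x, x ∉ L.lattice → L.weierstrassP x = L.weierstrassP z := fun x hx ↦
    hopen.is_const_of_deriv_eq_zero hconn L.differentiableOn_weierstrassP
      (by rw [L.deriv_weierstrassP]; exact hzero) hx hz
  obtain ⟨y, hy, hyz⟩ := L.exists_weierstrassP_eq (L.weierstrassP z + 1)
  rw [hconst y hy] at hyz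
  simp at hyz

/-- `℘'' = 6℘² - g₂/2` away from the lattice. -/
lemma hasDerivAt_derivWeierstrassP {z : ℂ} (hz : z ∉ L.lattice) :
    HasDerivAt L.derivWeierstrassP (6 * L.weierstrassP z ^ 2 - L.g₂ / 2) z := by
  have hopen : IsOpen ((L.lattice : Set ℂ)ᶜ) := L.isClosed_lattice.isOpen_compl
  have hP := L.analyticOnNhd_weierstrassP z hz
  have hP' := L.analyticOnNhd_derivWeierstrassP z hz
  have hd : ∀ w, w ∉ L.lattice →
      HasDerivAt L.derivWeierstrassP (deriv L.derivWeierstrassP w) w := fun w hw ↦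
    (L.analyticOnNhd_derivWeierstrassP w hw).differentiableAt.hasDerivAt
  -- This is the derivative of `℘'² = 4℘³ - g₂℘ - g₃`, divided by 2.
  have hmul : ∀ w, w ∉ L.lattice → L.derivWeierstrassP w *
      (deriv L.derivWeierstrassP w - (6 * L.weierstrassP w ^ 2 - L.g₂ / 2)) = 0 := by
    intro w hw
    have h1 := (hd w hw).pow 2
    have h2 := ((((L.hasDerivAt_weierstrassP hw).pow 3).const_mul 4).sub
      ((L.hasDerivAt_weierstrassP hw).const_mul L.g₂)).sub_const L.g₃
    have h3 := h1.unique (h2.congr_of_eventuallyEq (by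
      filter_upwards [hopen.mem_nhds hw] with y hy
      simpa using L.derivWeierstrassP_sq y hy))
    simp only [Nat.cast_ofNat] at h3
    linear_combination h3 / 2
  have han : AnalyticAt ℂ
      (fun w ↦ deriv L.derivWeierstrassP w - (6 * L.weierstrassP w ^ 2 - L.g₂ / 2)) z := by
    have := hP'.deriv
    fun_prop
  -- The zeros of `℘'` are isolated, so `℘'` cancels on a punctured neighbourhood; the other factor
  -- is analytic and therefore vanishes at `z` too.
  rcases (hP'.mul han).eventually_eq_zero_or_eventually_ne_zero with _ | h
  · rcases hP'.eventually_eq_zero_or_eventually_ne_zero with h' | h'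
    · exact absurd h' (L.not_eventually_derivWeierstrassP_eq_zero hz)
    · have : ∀ᶠ w in 𝓝[≠] z,
          deriv L.derivWeierstrassP w - (6 * L.weierstrassP w ^ 2 - L.g₂ / 2) = 0 := by
        filter_upwards [h', nhdsWithin_le_nhds (hopen.mem_nhds hz)] with w hw hw'
        exact (mul_eq_zero.mp (hmul w hw')).resolve_left hw
      have h0 := (han.frequently_zero_iff_eventually_zero.mp this.frequently).self_of_nhds
      rw [← sub_eq_zero.mp h0]
      exact hd z hz
  · exfalso
    obtain ⟨w, hw, hw'⟩ := (h.and (nhdsWithin_le_nhds (hopen.mem_nhds hz))).exists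
    exact hw (hmul w hw')

end PeriodPair

namespace Ridge

/-! ### Lattices with prescribed invariants -/

section ModularForms

open ModularForm ModularFormClass UpperHalfPlane MatrixGroups EisensteinSeries

lemma tendsto_atImInfty_qExpansion_coeff_zero {k : ℤ} (f : ModularForm 𝒮ℒ k) :
    Tendsto f atImInfty (𝓝 ((qExpansion 1 f).coeff 0)) := by
  have hper := SlashInvariantFormClass.periodic_comp_ofComplex f one_mem_strictPeriods_SL
  have han : AnalyticAt ℂ (cuspFunction 1 f) 0 :=
    UpperHalfPlane.analyticAt_cuspFunction_zero one_pos hper (holo f) (bdd_at_infty f)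
  have hcomp : (cuspFunction 1 f ∘ fun τ : ℍ ↦ Function.Periodic.qParam 1 τ) = f := by
    funext τ
    simpa using UpperHalfPlane.eq_cuspFunction τ one_ne_zero hper
  rw [UpperHalfPlane.qExpansion_coeff_zero one_pos han hper,
    ← cuspFunction_apply_zero one_pos han hper]
  simpa [hcomp] using han.continuousAt.tendsto.comp (qParam_tendsto_atImInfty one_pos)

/-- A level one modular form of positive weight that does not vanish at the cusp has a zero in the
upper half plane: otherwise its inverse would be a modular form of negative weight. -/
lemma exists_zero_of_tendsto_atImInfty {k : ℤ} (hk : 0 < k) (f : ModularForm 𝒮ℒ k) {c : ℂ}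
    (hc : c ≠ 0) (hf : Tendsto f atImInfty (𝓝 c)) : ∃ z, f z = 0 := by
  by_contra! hne
  have hslash (γ : SL(2, ℤ)) : (fun z ↦ (1 : ModularForm 𝒮ℒ 0) z / f z) ∣[0 - k] γ =
      fun z ↦ (1 : ModularForm 𝒮ℒ 0) z / f z := by
    have hγ : (γ : GL (Fin 2) ℝ) ∈ 𝒮ℒ := ⟨γ, rfl⟩
    change (⇑(1 : ModularForm 𝒮ℒ 0) / ⇑f) ∣[0 - k] γ = ⇑(1 : ModularForm 𝒮ℒ 0) / ⇑f
    simp_rw [div_slash_SL2, SL_slash, SlashInvariantForm.slash_action_eqn _ _ hγ]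
  let g : ModularForm 𝒮ℒ (0 - k) :=
    { toFun z := (1 : ModularForm 𝒮ℒ 0) z / f z
      slash_action_eq' := fun _ ⟨γ, hγ⟩ ↦ hγ ▸ hslash γ
      holo' := (1 : ModularForm 𝒮ℒ 0).holo'.div f.holo' hne
      bdd_at_cusps' {c} hc := by
        rw [Subgroup.IsArithmetic.isCusp_iff_isCusp_SL2Z] at hc
        rw [OnePoint.isBoundedAt_iff_forall_SL2Z hc]
        intro γ _
        rw [hslash γ, IsBoundedAtImInfty, BoundedAtFilter]
        exact ((tendsto_const_nhds (x := (1 : ℂ))).div hf ‹_›).isBigO_one ℝ }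
  have hg : (g : ℍ → ℂ) = 0 := levelOne_neg_weight_eq_zero (by lia) g
  have hI : (1 : ℂ) / f I = 0 := congr_fun hg I
  exact div_ne_zero one_ne_zero (hne I) hI

/-- Both Eisenstein series tend to 1 at the cusp, so the weight 12 form `A E₄³ - B E₆²` tends to `A
- B ≠ 0` and has a zero. -/
lemma exists_E₄_cube_E₆_sq_ratio {A B : ℂ} (h : A ≠ B) : ∃ z : ℍ, A * E₄ z ^ 3 = B * E₆ z ^ 2 := by
  let f : ModularForm 𝒮ℒ 12 := A • ModularForm.mcast (by decide) (E₄.pow 3) -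
    B • ModularForm.mcast (by decide) (E₆.pow 2)
  have hf (z : ℍ) : f z = A * E₄ z ^ 3 - B * E₆ z ^ 2 := by
    simp only [f, coe_mcast, ModularForm.coe_pow, sub_apply, Pi.pow_apply,
      smul_apply, smul_eq_mul]
  have h4 := tendsto_atImInfty_qExpansion_coeff_zero E₄
  have h6 := tendsto_atImInfty_qExpansion_coeff_zero E₆
  rw [E_qExpansion_coeff_zero _ ⟨2, rfl⟩] at h4
  rw [E_qExpansion_coeff_zero _ ⟨3, rfl⟩] at h6
  have ht : Tendsto f atImInfty (𝓝 (A - B)) := by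
    have := ((h4.pow 3).const_mul A).sub ((h6.pow 2).const_mul B)
    simp only [one_pow, mul_one] at this
    exact this.congr fun z ↦ (hf z).symm
  obtain ⟨z, hz⟩ := exists_zero_of_tendsto_atImInfty (by norm_num) f (sub_ne_zero.mpr h) ht
  exact ⟨z, sub_eq_zero.mp ((hf z).symm.trans hz)⟩

/-- The lattice `c (ℤ τ + ℤ)`. -/
noncomputable def scaledPeriodPair (τ : ℍ) (c : ℂ) (hc : c ≠ 0) : PeriodPair where
  ω₁ := c * τ
  ω₂ := c
  indep := by
    rw [LinearIndependent.pair_iff]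
    intro s t h
    have h' : (s : ℂ) * τ + t = 0 := by
      refine (mul_eq_zero.mp (?_ : c * ((s : ℂ) * τ + t) = 0)).resolve_left hc
      simp only [Complex.real_smul] at h
      linear_combination h
    have him := congr_arg Complex.im h'
    have hre := congr_arg Complex.re h'
    simp at him hre
    have hs : s = 0 := him.resolve_right τ.im_ne_zero
    subst hs
    simpa using hre

/-- `G` is homogeneous of degree `-k` in the lattice, and the sum over `ℤ τ + ℤ` is `2 ζ(k) E_k(τ)`.
-/
lemma G_scaledPeriodPair (τ : ℍ) {c : ℂ} (hc : c ≠ 0) {k : ℕ} (hk : 3 ≤ k) :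
    (scaledPeriodPair τ c hc).G k = (c ^ k)⁻¹ * (2 * riemannZeta k * E hk τ) := by
  have hE : E hk τ = 1 / 2 * eisensteinSeries (N := 1) 0 k τ := rfl
  have h2 : 2 * riemannZeta k * E hk τ = ∑' v : Fin 2 → ℤ, eisSummand k v τ := by
    rw [tsum_eisSummand_eq_riemannZeta_mul_eisensteinSeries hk, hE]
    ring
  rw [h2, ← tsum_mul_left, PeriodPair.G,
    ← ((finTwoArrowEquiv ℤ).trans
      (scaledPeriodPair τ c hc).latticeEquivProd.symm.toEquiv).tsum_eq]
  refine tsum_congr fun v ↦ ?_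
  have : (((scaledPeriodPair τ c hc).latticeEquivProd.symm (v 0, v 1) :
      (scaledPeriodPair τ c hc).lattice) : ℂ) = c * (v 0 * τ + v 1) := by
    rw [PeriodPair.latticeEquiv_symm_apply]
    simp only [scaledPeriodPair]
    ring
  change ((((scaledPeriodPair τ c hc).latticeEquivProd.symm (v 0, v 1) :
    (scaledPeriodPair τ c hc).lattice) : ℂ) ^ k)⁻¹ = _ * (v 0 * (τ : ℂ) + v 1) ^ (-(k : ℤ))
  rw [this, zpow_neg, zpow_natCast, mul_pow, mul_inv]

lemma riemannZeta_six : riemannZeta 6 = Real.pi ^ 6 / 945 := by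
  have h := riemannZeta_two_mul_nat (k := 3) (by norm_num)
  rw [show (bernoulli (2 * 3) : ℚ) = 1 / 42 by
    have h5 : bernoulli' 5 = 0 := bernoulli'_eq_zero_of_odd ⟨2, rfl⟩ (by norm_num)
    rw [bernoulli_eq_bernoulli'_of_ne_one (by norm_num), bernoulli'_def]
    norm_num [Finset.sum_range_succ, h5, Nat.choose]] at h
  norm_num [Nat.factorial] at h
  rw [h]
  ring

end ModularForms

/-- Every pair of complex numbers with nonzero discriminant is the pair of invariants of a
lattice. -/
theorem exists_periodPair_of_discriminant_ne_zero {α β : ℂ} (h : α ^ 3 ≠ 27 * β ^ 2) :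
    ∃ L : PeriodPair, L.g₂ = α ∧ L.g₃ = β := by
  obtain ⟨τ, hτ⟩ := exists_E₄_cube_E₆_sq_ratio h.symm
  have hπ : (Real.pi : ℂ) ≠ 0 := by exact_mod_cast Real.pi_ne_zero
  -- `u` and `v` are the invariants of `ℤ τ + ℤ`; `τ` was chosen to give `u³ : v²` the prescribed
  -- ratio.
  set u : ℂ := 4 / 3 * Real.pi ^ 4 * ModularForm.E₄ τ with hu
  set v : ℂ := 8 / 27 * Real.pi ^ 6 * ModularForm.E₆ τ with hv
  have huv : β ^ 2 * u ^ 3 = α ^ 3 * v ^ 2 := by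
    rw [hu, hv]
    linear_combination (64 / 729 * Real.pi ^ 12 : ℂ) * hτ
  have hdisc : u ^ 3 ≠ 27 * v ^ 2 := by
    intro h0
    apply ModularForm.discriminant_ne_zero τ
    rw [ModularForm.discriminant_eq_E₄_cube_sub_E₆_sq]
    have : (64 / 27 * Real.pi ^ 12 : ℂ) *
        (ModularForm.E₄ τ ^ 3 - ModularForm.E₆ τ ^ 2) = 0 := by
      rw [hu, hv] at h0
      linear_combination h0
    rw [(mul_eq_zero.mp this).resolve_left (mul_ne_zero (by norm_num) (pow_ne_zero _ hπ)), zero_div]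
  -- Scaling the lattice by `c` multiplies the invariants by `c⁻⁴` and `c⁻⁶`, so `m` stands for
  -- `c⁻²`. It is the quotient of `β / v` by `α / u`, unless `u` or `v` is zero and a single root
  -- suffices.
  obtain ⟨m, hm0, hm2, hm3⟩ : ∃ m : ℂ, m ≠ 0 ∧ m ^ 2 * u = α ∧ m ^ 3 * v = β := by
    by_cases hu0 : u = 0
    · have hv0 : v ≠ 0 := by rintro hv0; exact hdisc (by simp [hu0, hv0])
      have hα : α = 0 := by simpa [hu0, hv0] using huv
      have hβ : β ≠ 0 := by rintro hβ; exact h (by simp [hα, hβ])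
      obtain ⟨m, hm⟩ := IsAlgClosed.exists_pow_nat_eq (β / v) (n := 3) (by norm_num)
      refine ⟨m, ?_, by simp [hu0, hα], by rw [hm]; field_simp⟩
      rintro rfl
      exact div_ne_zero hβ hv0 (by simpa using hm.symm)
    · by_cases hv0 : v = 0
      · have hβ : β = 0 := by simpa [hu0, hv0] using huv
        have hα : α ≠ 0 := by rintro hα; exact h (by simp [hα, hβ])
        obtain ⟨m, hm⟩ := IsAlgClosed.exists_pow_nat_eq (α / u) (n := 2) (by norm_num)
        refine ⟨m, ?_, by rw [hm]; field_simp, by simp [hv0, hβ]⟩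
        rintro rfl
        exact div_ne_zero hα hu0 (by simpa using hm.symm)
      · have hα : α ≠ 0 := by
          rintro rfl
          have hβ : β = 0 := by simpa [hu0] using huv
          exact h (by simp [hβ])
        have hβ : β ≠ 0 := by
          rintro rfl
          simp [hα, hv0] at huv
        refine ⟨β * u / (α * v), by positivity, ?_, ?_⟩
        · field_simp
          linear_combination huv
        · field_simp
          linear_combination huv
  obtain ⟨c, hc⟩ := IsAlgClosed.exists_pow_nat_eq m⁻¹ (n := 2) (by norm_num)
  have hc0 : c ≠ 0 := by
    rintro rfl
    exact inv_ne_zero hm0 (by simpa using hc.symm)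
  have hc4 : (c ^ 4)⁻¹ = m ^ 2 := by rw [show c ^ 4 = (c ^ 2) ^ 2 by ring, hc]; simp
  have hc6 : (c ^ 6)⁻¹ = m ^ 3 := by rw [show c ^ 6 = (c ^ 2) ^ 3 by ring, hc]; simp
  have h4 := riemannZeta_four
  have h6 := riemannZeta_six
  refine ⟨scaledPeriodPair τ c hc0, ?_, ?_⟩
  · rw [PeriodPair.g₂, G_scaledPeriodPair τ hc0 (by norm_num), hc4, ← hm2, hu]
    push_cast
    rw [h4]
    ring
  · rw [PeriodPair.g₃, G_scaledPeriodPair τ hc0 (by norm_num), hc6, ← hm3, hv]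
    push_cast
    rw [h6]
    ring

/-! ### Completeness of Lipschitz vector fields -/

section GlobalODE

variable {E : Type*} [NormedAddCommGroup E] [NormedSpace ℝ E] [CompleteSpace E]

/-- A Lipschitz vector field has an integral curve through each point on a time interval whose
length does not depend on the point. -/
lemma exists_local_solution_of_lipschitz {f : E → E} {K : NNReal} (hf : LipschitzWith K f) (x : E) :
    ∃ γ : ℝ → E, γ 0 = x ∧ ∀ t ∈ Set.Ioo (-(‖f 0‖ + 2 * K + 1)⁻¹) (‖f 0‖ + 2 * K + 1)⁻¹,
      HasDerivAt γ (f (γ t)) t := by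
  set ε : ℝ := (‖f 0‖ + 2 * K + 1)⁻¹ with hε
  have hpos : 0 < ‖f 0‖ + 2 * K + 1 := by positivity
  have hε0 : 0 < ε := by positivity
  have h0 : (0 : ℝ) ∈ Set.Icc (-ε) ε := ⟨by linarith, hε0.le⟩
  -- On the ball of radius `1 + ‖x‖` about `x` the field is at most `(‖f 0‖ + 2K)(1 + ‖x‖)`; the
  -- factor `1 + ‖x‖` cancels from the admissible time.
  have hpl : IsPicardLindelof (fun _ ↦ f) (⟨0, h0⟩ : Set.Icc (-ε) ε) x (1 + ‖x‖₊) 0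
      ((‖f 0‖₊ + 2 * K) * (1 + ‖x‖₊)) K := by
    refine ⟨fun _ _ ↦ hf.lipschitzOnWith, fun _ _ ↦ continuousOn_const, fun _ _ y hy ↦ ?_, ?_⟩
    · have hy' : ‖y‖ ≤ 1 + 2 * ‖x‖ := by
        have h1 : ‖y - x‖ ≤ 1 + ‖x‖ := by simpa [dist_eq_norm] using hy
        have h2 := norm_add_le (y - x) x
        rw [sub_add_cancel] at h2
        linarith
      have h3 : ‖f y - f 0‖ ≤ K * ‖y‖ := by simpa [dist_eq_norm] using hf.dist_le_mul y 0
      have h4 := norm_add_le (f y - f 0) (f 0)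
      rw [sub_add_cancel] at h4
      have h5 : (K : ℝ) * ‖y‖ ≤ K * (1 + 2 * ‖x‖) := by gcongr
      have h6 : 0 ≤ ‖f 0‖ * ‖x‖ := by positivity
      have h7 : (0 : ℝ) ≤ K := K.2
      push_cast
      nlinarith
    · push_cast
      simp only [sub_zero, zero_sub, neg_neg, max_self]
      have : (‖f 0‖ + 2 * K) * ε ≤ 1 := by
        rw [hε, ← div_eq_mul_inv, div_le_one hpos]
        linarith
      calc (‖f 0‖ + 2 * K) * (1 + ‖x‖) * ε = (‖f 0‖ + 2 * K) * ε * (1 + ‖x‖) := by ring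
        _ ≤ 1 * (1 + ‖x‖) := by gcongr
        _ = 1 + ‖x‖ := one_mul _
  obtain ⟨γ, hγ0, hγ⟩ := hpl.exists_eq_forall_mem_Icc_hasDerivWithinAt₀
  exact ⟨γ, hγ0, fun t ht ↦ (hγ t (Set.Ioo_subset_Icc_self ht)).hasDerivAt
    (Icc_mem_nhds ht.1 ht.2)⟩

open scoped Manifold in
/-- A Lipschitz vector field of class `C¹` is complete. -/
theorem exists_global_solution_of_lipschitz {f : E → E} {K : NNReal} (hf : LipschitzWith K f)
    (hf' : ContDiff ℝ 1 f) (x : E) : ∃ γ : ℝ → E, γ 0 = x ∧ ∀ t, HasDerivAt γ (f (γ t)) t := by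
  have hpos : 0 < (‖f 0‖ + 2 * K + 1)⁻¹ := by positivity
  obtain ⟨γ, hγ0, hγ⟩ := exists_isMIntegralCurve_of_isMIntegralCurveOn (I := 𝓘(ℝ, E)) (M := E)
    (v := f) (contMDiff_vectorSpace_iff_contDiff.mpr hf') hpos (fun y ↦ by
      obtain ⟨γ, hγ0, hγ⟩ := exists_local_solution_of_lipschitz hf y
      exact ⟨γ, hγ0, fun t ht ↦ (hγ t ht).hasFDerivAt.hasMFDerivAt.hasMFDerivWithinAt⟩) x
  refine ⟨γ, hγ0, fun t ↦ ?_⟩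
  have h : HasFDerivAt γ ((1 : ℝ →L[ℝ] ℝ).smulRight (f (γ t))) t := (hγ t).hasFDerivAt
  simpa using h.hasDerivAt

end GlobalODE

/-! ### The equation of motion of the first coordinate -/

lemma exists_Ioo_subset_of_isPreconnected {I : Set ℝ} (hI : IsOpen I) (hI' : IsPreconnected I)
    {s t : ℝ} (hs : s ∈ I) (ht : t ∈ I) :
    ∃ l u, s ∈ Set.Ioo l u ∧ t ∈ Set.Ioo l u ∧ Set.Ioo l u ⊆ I := by
  have hm : min s t ∈ I := by rcases min_choice s t with h | h <;> rwa [h]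
  have hM : max s t ∈ I := by rcases max_choice s t with h | h <;> rwa [h]
  obtain ⟨l, hl, hl'⟩ := exists_Ioc_subset_of_mem_nhds (hI.mem_nhds hm) (exists_lt _)
  obtain ⟨u, hu, hu'⟩ := exists_Ico_subset_of_mem_nhds (hI.mem_nhds hM) (exists_gt _)
  refine ⟨l, u, ⟨hl.trans_le (min_le_left _ _), (le_max_left _ _).trans_lt hu⟩,
    ⟨hl.trans_le (min_le_right _ _), (le_max_right _ _).trans_lt hu⟩, fun y hy ↦ ?_⟩
  rcases le_total y (min s t) with h | h
  · exact hl' ⟨hy.1, h⟩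
  rcases le_total (max s t) y with h' | h'
  · exact hu' ⟨h', hy.2⟩
  · exact hI'.ordConnected.out hm hM ⟨h, h'⟩

/-- A bounded Lipschitz function on the line. -/
def IsBoundedLipschitz (f : ℝ → ℝ) : Prop :=
  ∃ C, 0 ≤ C ∧ (∀ x, |f x| ≤ C) ∧ ∀ x y, |f x - f y| ≤ C * |x - y|

namespace IsBoundedLipschitz

lemma const (c : ℝ) : IsBoundedLipschitz fun _ ↦ c :=
  ⟨|c|, abs_nonneg c, fun _ ↦ le_rfl, fun x y ↦ by simpa using by positivity⟩

lemma mul {f g : ℝ → ℝ} (hf : IsBoundedLipschitz f) (hg : IsBoundedLipschitz g) :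
    IsBoundedLipschitz fun x ↦ f x * g x := by
  obtain ⟨C, hC, hf1, hf2⟩ := hf
  obtain ⟨C', hC', hg1, hg2⟩ := hg
  refine ⟨2 * (C * C'), by positivity, fun x ↦ ?_, fun x y ↦ ?_⟩
  · rw [abs_mul]
    have : |f x| * |g x| ≤ C * C' := by gcongr <;> grind
    nlinarith [mul_nonneg hC hC']
  · calc |f x * g x - f y * g y| = |f x * (g x - g y) + (f x - f y) * g y| := by ring_nf
      _ ≤ |f x| * |g x - g y| + |f x - f y| * |g y| := by
        rw [← abs_mul, ← abs_mul]; exact abs_add_le _ _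
      _ ≤ C * (C' * |x - y|) + C * |x - y| * C' := by
        gcongr
        exacts [hf1 x, hg2 x y, hf2 x y, hg1 y]
      _ = 2 * (C * C') * |x - y| := by ring

lemma add {f g : ℝ → ℝ} (hf : IsBoundedLipschitz f) (hg : IsBoundedLipschitz g) :
    IsBoundedLipschitz fun x ↦ f x + g x := by
  obtain ⟨C, hC, hf1, hf2⟩ := hf
  obtain ⟨C', hC', hg1, hg2⟩ := hg
  refine ⟨C + C', by positivity, fun x ↦ (abs_add_le _ _).trans (add_le_add (hf1 x) (hg1 x)),
    fun x y ↦ ?_⟩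
  calc |f x + g x - (f y + g y)| = |(f x - f y) + (g x - g y)| := by ring_nf
    _ ≤ |f x - f y| + |g x - g y| := abs_add_le _ _
    _ ≤ C * |x - y| + C' * |x - y| := add_le_add (hf2 x y) (hg2 x y)
    _ = (C + C') * |x - y| := by ring

lemma abs_le_mul_sq_add {a : ℝ} (ha : 0 < a) (x : ℝ) : |x| ≤ (1 + a⁻¹) * (x ^ 2 + a) := by
  have h1 : (1 + a⁻¹) * (x ^ 2 + a) = x ^ 2 + a + a⁻¹ * x ^ 2 + 1 := by field_simp; ring
  have h2 : 0 ≤ a⁻¹ * x ^ 2 := by positivity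
  rw [h1, ← sq_abs x]
  rw [← sq_abs x] at h2
  nlinarith [sq_nonneg (|x| - 1)]

lemma inv_sq_add {a : ℝ} (ha : 0 < a) : IsBoundedLipschitz fun x ↦ (x ^ 2 + a)⁻¹ := by
  refine ⟨a⁻¹ + 2 * ((1 + a⁻¹) * a⁻¹), by positivity, fun x ↦ ?_, fun x y ↦ ?_⟩
  · rw [abs_of_pos (by positivity)]
    have : (x ^ 2 + a)⁻¹ ≤ a⁻¹ := inv_anti₀ ha (by nlinarith [sq_nonneg x])
    have : 0 ≤ 2 * ((1 + a⁻¹) * a⁻¹) := by positivity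
    linarith
  · have hx : 0 < x ^ 2 + a := by positivity
    have hy : 0 < y ^ 2 + a := by positivity
    have key : |x + y| * (x ^ 2 + a)⁻¹ * (y ^ 2 + a)⁻¹ ≤ 2 * ((1 + a⁻¹) * a⁻¹) := by
      have h1 : |x| * (x ^ 2 + a)⁻¹ ≤ 1 + a⁻¹ := by
        rw [← div_eq_mul_inv, div_le_iff₀ hx]; exact abs_le_mul_sq_add ha x
      have h2 : |y| * (y ^ 2 + a)⁻¹ ≤ 1 + a⁻¹ := by
        rw [← div_eq_mul_inv, div_le_iff₀ hy]; exact abs_le_mul_sq_add ha y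
      have h3 : (x ^ 2 + a)⁻¹ ≤ a⁻¹ := inv_anti₀ ha (by nlinarith [sq_nonneg x])
      have h4 : (y ^ 2 + a)⁻¹ ≤ a⁻¹ := inv_anti₀ ha (by nlinarith [sq_nonneg y])
      calc |x + y| * (x ^ 2 + a)⁻¹ * (y ^ 2 + a)⁻¹
          ≤ (|x| + |y|) * (x ^ 2 + a)⁻¹ * (y ^ 2 + a)⁻¹ := by
            gcongr; exact abs_add_le _ _
        _ = |x| * (x ^ 2 + a)⁻¹ * (y ^ 2 + a)⁻¹ + |y| * (y ^ 2 + a)⁻¹ * (x ^ 2 + a)⁻¹ := by ring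
        _ ≤ (1 + a⁻¹) * a⁻¹ + (1 + a⁻¹) * a⁻¹ := by gcongr
        _ = _ := by ring
    have heq : (x ^ 2 + a)⁻¹ - (y ^ 2 + a)⁻¹ =
        -((x - y) * ((x + y) * (x ^ 2 + a)⁻¹ * (y ^ 2 + a)⁻¹)) := by
      field_simp; ring
    rw [heq, abs_neg, abs_mul, abs_mul, abs_mul, abs_of_pos (inv_pos.mpr hx),
      abs_of_pos (inv_pos.mpr hy), mul_comm]
    gcongr
    have : 0 < a⁻¹ := inv_pos.mpr ha
    linarith

lemma mul_inv_sq_add {a : ℝ} (ha : 0 < a) : IsBoundedLipschitz fun x ↦ x * (x ^ 2 + a)⁻¹ := by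
  have hb (x : ℝ) : |x| * (x ^ 2 + a)⁻¹ ≤ 1 + a⁻¹ := by
    rw [← div_eq_mul_inv, div_le_iff₀ (by positivity)]; exact abs_le_mul_sq_add ha x
  refine ⟨1 + a⁻¹ + (a⁻¹ + (1 + a⁻¹) * (1 + a⁻¹)), by positivity, fun x ↦ ?_, fun x y ↦ ?_⟩
  · rw [abs_mul, abs_of_pos (a := (x ^ 2 + a)⁻¹) (by positivity)]
    have : 0 ≤ a⁻¹ + (1 + a⁻¹) * (1 + a⁻¹) := by positivity
    linarith [hb x]
  · have hx : 0 < x ^ 2 + a := by positivity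
    have hy : 0 < y ^ 2 + a := by positivity
    have h3 : (x ^ 2 + a)⁻¹ ≤ a⁻¹ := inv_anti₀ ha (by nlinarith [sq_nonneg x])
    have h4 : (y ^ 2 + a)⁻¹ ≤ a⁻¹ := inv_anti₀ ha (by nlinarith [sq_nonneg y])
    have key : |a - x * y| * (x ^ 2 + a)⁻¹ * (y ^ 2 + a)⁻¹ ≤
        a⁻¹ + (1 + a⁻¹) * (1 + a⁻¹) := by
      calc |a - x * y| * (x ^ 2 + a)⁻¹ * (y ^ 2 + a)⁻¹
          ≤ (a + |x| * |y|) * (x ^ 2 + a)⁻¹ * (y ^ 2 + a)⁻¹ := by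
            gcongr
            rw [← abs_mul]
            exact (abs_sub _ _).trans_eq (by rw [abs_of_pos ha])
        _ = a * (x ^ 2 + a)⁻¹ * (y ^ 2 + a)⁻¹ +
            (|x| * (x ^ 2 + a)⁻¹) * (|y| * (y ^ 2 + a)⁻¹) := by ring
        _ ≤ a * a⁻¹ * a⁻¹ + (1 + a⁻¹) * (1 + a⁻¹) := by
            gcongr
            exacts [hb x, hb y]
        _ = _ := by rw [mul_inv_cancel₀ ha.ne', one_mul]
    have heq : x * (x ^ 2 + a)⁻¹ - y * (y ^ 2 + a)⁻¹ =
        (x - y) * ((a - x * y) * (x ^ 2 + a)⁻¹ * (y ^ 2 + a)⁻¹) := by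
      field_simp; ring
    rw [heq, abs_mul, abs_mul, abs_mul, abs_of_pos (inv_pos.mpr hx),
      abs_of_pos (inv_pos.mpr hy), mul_comm]
    gcongr
    have : 0 < a⁻¹ := inv_pos.mpr ha
    linarith

end IsBoundedLipschitz

/-- The acceleration `½ (D - κ D²)'` of the first coordinate along a trajectory. -/
noncomputable def acceleration (a b κ x : ℝ) : ℝ :=
  (a - b) * x / (x ^ 2 + a) ^ 2 * (1 - 2 * κ * depth a b x 0)

lemma depth_pos {a b : ℝ} (ha : 0 < a) (hb : 0 < b) (x y : ℝ) : 0 < depth a b x y := by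
  unfold depth; positivity

lemma depth_eq_one_add {a : ℝ} (ha : 0 < a) (b x y : ℝ) :
    depth a b x y = 1 + (b - a) * (x ^ 2 + a)⁻¹ := by
  have : x ^ 2 + a ≠ 0 := by positivity
  unfold depth; field_simp; ring

lemma hasDerivAt_depth {a : ℝ} (ha : 0 < a) (b x y : ℝ) :
    HasDerivAt (fun u ↦ depth a b u y) (2 * ((a - b) * x / (x ^ 2 + a) ^ 2)) x := by
  have h0 : x ^ 2 + a ≠ 0 := by positivity
  have h1 := ((hasDerivAt_pow 2 x).add_const b).fun_div ((hasDerivAt_pow 2 x).add_const a) h0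
  refine h1.congr_deriv ?_
  field_simp
  push_cast
  ring

/-- The acceleration is a polynomial in `(x² + a)⁻¹` and `x (x² + a)⁻¹`, and bounded Lipschitz
functions form an algebra. -/
lemma isBoundedLipschitz_acceleration {a : ℝ} (ha : 0 < a) (b κ : ℝ) :
    IsBoundedLipschitz (acceleration a b κ) := by
  have hw := IsBoundedLipschitz.mul_inv_sq_add ha
  have hu := IsBoundedLipschitz.inv_sq_add ha
  have h := ((IsBoundedLipschitz.const (a - b)).mul (hw.mul hu)).mul
    ((IsBoundedLipschitz.const (1 - 2 * κ)).add
      ((IsBoundedLipschitz.const (-(2 * κ * (b - a)))).mul hu))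
  convert h using 1
  funext x
  have h0 : x ^ 2 + a ≠ 0 := by positivity
  rw [acceleration, depth_eq_one_add ha]
  field_simp
  ring

/-- The vector field of the second order equation `ẍ = ½ (D - κ D²)'(x)`. -/
noncomputable def planarField (a b κ : ℝ) (q : ℝ × ℝ) : ℝ × ℝ := (q.2, acceleration a b κ q.1)

lemma exists_lipschitzWith_planarField {a : ℝ} (ha : 0 < a) (b κ : ℝ) :
    ∃ K, LipschitzWith K (planarField a b κ) := by
  obtain ⟨C, hC, -, h⟩ := isBoundedLipschitz_acceleration ha b κ
  refine ⟨⟨1 + C, by positivity⟩, LipschitzWith.of_dist_le_mul fun q r ↦ ?_⟩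
  change dist _ _ ≤ (1 + C) * dist q r
  rw [Prod.dist_eq]
  have h1 : dist q.1 r.1 ≤ dist q r := le_max_left _ _
  have h2 : dist q.2 r.2 ≤ dist q r := le_max_right _ _
  have h0 : 0 ≤ dist q r := dist_nonneg
  refine max_le ?_ ?_
  · exact h2.trans (by nlinarith)
  · calc dist (acceleration a b κ q.1) (acceleration a b κ r.1) ≤ C * dist q.1 r.1 := h _ _
      _ ≤ C * dist q r := by gcongr
      _ ≤ (1 + C) * dist q r := by nlinarith

lemma contDiff_planarField {a : ℝ} (ha : 0 < a) (b κ : ℝ) : ContDiff ℝ 1 (planarField a b κ) := by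
  have h : ContDiff ℝ 1 (acceleration a b κ) := by
    unfold acceleration depth
    have h0 (x : ℝ) : x ^ 2 + a ≠ 0 := by positivity
    exact ((contDiff_const.mul contDiff_id).div (by fun_prop) fun x ↦ pow_ne_zero 2 (h0 x)).mul
      (contDiff_const.sub (contDiff_const.mul (ContDiff.div (by fun_prop) (by fun_prop) h0)))
  exact contDiff_snd.prodMk (h.comp contDiff_fst)

lemma exists_planar_solution {a : ℝ} (ha : 0 < a) (b κ x₀ v₀ : ℝ) :
    ∃ x v : ℝ → ℝ, x 0 = x₀ ∧ v 0 = v₀ ∧ (∀ t, HasDerivAt x (v t) t) ∧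
      ∀ t, HasDerivAt v (acceleration a b κ (x t)) t := by
  obtain ⟨K, hK⟩ := exists_lipschitzWith_planarField ha b κ
  obtain ⟨γ, hγ0, hγ⟩ :=
    exists_global_solution_of_lipschitz hK (contDiff_planarField ha b κ) (x₀, v₀)
  exact ⟨fun t ↦ (γ t).1, fun t ↦ (γ t).2, by simp [hγ0], by simp [hγ0],
    fun t ↦ (hγ t).fst, fun t ↦ (hγ t).snd⟩

lemma planar_solution_unique {a : ℝ} (ha : 0 < a) (b κ : ℝ) {I : Set ℝ} (hI : IsOpen I)
    (hI' : IsPreconnected I) (h0 : 0 ∈ I) {x v y w : ℝ → ℝ}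
    (hx : ∀ t ∈ I, HasDerivAt x (v t) t) (hv : ∀ t ∈ I, HasDerivAt v (acceleration a b κ (x t)) t)
    (hy : ∀ t ∈ I, HasDerivAt y (w t) t) (hw : ∀ t ∈ I, HasDerivAt w (acceleration a b κ (y t)) t)
    (hxy : x 0 = y 0) (hvw : v 0 = w 0) : ∀ t ∈ I, x t = y t ∧ v t = w t := by
  intro t ht
  obtain ⟨K, hK⟩ := exists_lipschitzWith_planarField ha b κ
  obtain ⟨l, u, h0', ht', hsub⟩ := exists_Ioo_subset_of_isPreconnected hI hI' h0 ht
  have := ODE_solution_unique_of_mem_Ioo (v := fun _ ↦ planarField a b κ) (s := fun _ ↦ Set.univ)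
    (f := fun t ↦ (x t, v t)) (g := fun t ↦ (y t, w t)) (fun _ _ ↦ hK.lipschitzOnWith) h0'
    (fun t ht ↦ ⟨(hx t (hsub ht)).prodMk (hv t (hsub ht)), trivial⟩)
    (fun t ht ↦ ⟨(hy t (hsub ht)).prodMk (hw t (hsub ht)), trivial⟩)
    (by simp [hxy, hvw]) ht'
  simpa using this

/-- Conservation of energy for `ẍ = ½ (D - κ D²)'(x)`. -/
lemma planar_energy {a : ℝ} (ha : 0 < a) (b κ : ℝ) {x v : ℝ → ℝ}
    (hx : ∀ t, HasDerivAt x (v t) t) (hv : ∀ t, HasDerivAt v (acceleration a b κ (x t)) t)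
    (h0 : v 0 ^ 2 = depth a b (x 0) 0 - κ * depth a b (x 0) 0 ^ 2) (t : ℝ) :
    v t ^ 2 = depth a b (x t) 0 - κ * depth a b (x t) 0 ^ 2 := by
  have hD (t : ℝ) := (hasDerivAt_depth ha b (x t) 0).comp t (hx t)
  have hd (t : ℝ) : HasDerivAt (fun t ↦ v t ^ 2 - (depth a b (x t) 0 - κ * depth a b (x t) 0 ^ 2))
      0 t := by
    refine (((hv t).fun_pow 2).fun_sub
      ((hD t).fun_sub (((hD t).fun_pow 2).const_mul κ))).congr_deriv ?_
    simp only [acceleration, Function.comp]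
    push_cast
    ring
  have := is_const_of_deriv_eq_zero (fun t ↦ (hd t).differentiableAt) (fun t ↦ (hd t).deriv) t 0
  linarith

/-! ### Conservation laws and reduction of the Hamiltonian system -/

section Hamiltonian

variable {a b : ℝ}

lemma sq_add_sq_pos {p₁ p₂ : ℝ} (h : ¬ (p₁ = 0 ∧ p₂ = 0)) : 0 < p₁ ^ 2 + p₂ ^ 2 := by
  rcases not_and_or.mp h with h | h <;> positivity

lemma deriv_hamiltonian_p₁ (x₁ x₂ : ℝ) {p₁ p₂ : ℝ} (h : ¬ (p₁ = 0 ∧ p₂ = 0)) :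
    deriv (fun u ↦ hamiltonian a b x₁ x₂ u p₂) p₁ =
      p₁ / √(p₁ ^ 2 + p₂ ^ 2) * √(depth a b x₁ x₂) := by
  have h0 := sq_add_sq_pos h
  have := ((((hasDerivAt_pow 2 p₁).add_const (p₂ ^ 2)).sqrt h0.ne').mul_const
    (√(depth a b x₁ x₂))).deriv
  refine this.trans ?_
  push_cast
  field_simp

lemma deriv_hamiltonian_p₂ (x₁ x₂ : ℝ) {p₁ p₂ : ℝ} (h : ¬ (p₁ = 0 ∧ p₂ = 0)) :
    deriv (fun u ↦ hamiltonian a b x₁ x₂ p₁ u) p₂ =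
      p₂ / √(p₁ ^ 2 + p₂ ^ 2) * √(depth a b x₁ x₂) := by
  have h0 := sq_add_sq_pos h
  have := ((((hasDerivAt_pow 2 p₂).const_add (p₁ ^ 2)).sqrt h0.ne').mul_const
    (√(depth a b x₁ x₂))).deriv
  refine this.trans ?_
  push_cast
  field_simp

lemma deriv_hamiltonian_x₁ (ha : 0 < a) (hb : 0 < b) (x₁ x₂ p₁ p₂ : ℝ) :
    deriv (fun u ↦ hamiltonian a b u x₂ p₁ p₂) x₁ =
      √(p₁ ^ 2 + p₂ ^ 2) * ((a - b) * x₁ / (x₁ ^ 2 + a) ^ 2 / √(depth a b x₁ x₂)) := by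
  have := (((hasDerivAt_depth ha b x₁ x₂).sqrt (depth_pos ha hb x₁ x₂).ne').const_mul
    (√(p₁ ^ 2 + p₂ ^ 2))).deriv
  refine this.trans ?_
  rw [mul_div_mul_left _ _ two_ne_zero]

lemma deriv_hamiltonian_x₂ (x₁ x₂ p₁ p₂ : ℝ) :
    deriv (fun u ↦ hamiltonian a b x₁ u p₁ p₂) x₂ = 0 :=
  deriv_const x₂ (√(p₁ ^ 2 + p₂ ^ 2) * √(depth a b x₁ x₂))

/-- With `N = |p|²`, this makes the equations of motion rational on a level set of `H`. -/
lemma sqrt_depth_div_sqrt {D N E : ℝ} (hD : 0 < D) (hN : 0 < N) (hE : 0 < E) (h : N * D = E ^ 2) :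
    √D / √N = D / E ∧ √N / √D = E / D := by
  have h1 : √N * √D = E := by
    rw [← Real.sqrt_mul hN.le, h, Real.sqrt_sq hE.le]
  have h2 := Real.mul_self_sqrt hD.le
  have h3 := Real.sqrt_pos.mpr hD
  have h4 := Real.sqrt_pos.mpr hN
  constructor
  · rw [div_eq_div_iff h4.ne' hE.ne', ← h1]
    linear_combination √N * h2
  · rw [div_eq_div_iff h3.ne' hD.ne', ← h1]
    linear_combination -√N * h2

/-- The velocities of the Hamiltonian system, on the level set `|p|² D = E²`. -/
lemma deriv_hamiltonian_of_level (ha : 0 < a) (hb : 0 < b) {E x₁ x₂ p₁ p₂ : ℝ} (hE : 0 < E)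
    (hp : ¬ (p₁ = 0 ∧ p₂ = 0)) (h : (p₁ ^ 2 + p₂ ^ 2) * depth a b x₁ 0 = E ^ 2) :
    deriv (fun u ↦ hamiltonian a b x₁ x₂ u p₂) p₁ = p₁ * depth a b x₁ 0 / E ∧
    deriv (fun u ↦ hamiltonian a b x₁ x₂ p₁ u) p₂ = p₂ * depth a b x₁ 0 / E ∧
    deriv (fun u ↦ hamiltonian a b u x₂ p₁ p₂) x₁ =
      (a - b) * x₁ / (x₁ ^ 2 + a) ^ 2 * (E / depth a b x₁ 0) := by
  obtain ⟨h1, h2⟩ := sqrt_depth_div_sqrt (depth_pos ha hb x₁ 0) (sq_add_sq_pos hp) hE h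
  refine ⟨?_, ?_, ?_⟩
  · rw [deriv_hamiltonian_p₁ x₁ x₂ hp, mul_div_assoc, ← h1, div_mul_eq_mul_div, ← mul_div_assoc]
    rfl
  · rw [deriv_hamiltonian_p₂ x₁ x₂ hp, mul_div_assoc, ← h1, div_mul_eq_mul_div, ← mul_div_assoc]
    rfl
  · rw [deriv_hamiltonian_x₁ ha hb, ← h2]
    change _ * (_ / √(depth a b x₁ 0)) = _
    ring

/-- On an open interval, a solution of the Hamiltonian system with the given initial data conserves
`p₂` and `|p|² D`. -/
lemma IsSolutionOn.conservation (ha : 0 < a) (hb : 0 < b) {ξ ψ : ℝ} {I : Set ℝ} (hI : IsOpen I)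
    (hI' : IsPreconnected I) (h0 : 0 ∈ I) {y₁ y₂ q₁ q₂ : ℝ → ℝ}
    (hs : IsSolutionOn a b I y₁ y₂ q₁ q₂) (hi : HasInitialData ξ ψ y₁ y₂ q₁ q₂) :
    ∀ t ∈ I, q₂ t = Real.sin ψ ∧
      (q₁ t ^ 2 + q₂ t ^ 2) * depth a b (y₁ t) 0 = depth a b ξ 0 := by
  have hq₂ : ∀ t ∈ I, HasDerivAt q₂ 0 t := fun t ht ↦
    (hs.p₂_dot t ht).congr_deriv (by rw [deriv_hamiltonian_x₂, neg_zero])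
  have hH : ∀ t ∈ I,
      HasDerivAt (fun t ↦ (q₁ t ^ 2 + q₂ t ^ 2) * depth a b (y₁ t) 0) 0 t := by
    intro t ht
    have hp := hs.momentum_ne_zero t ht
    have hN := sq_add_sq_pos hp
    have hD := depth_pos ha hb (y₁ t) 0
    have h1 := (hasDerivAt_depth ha b (y₁ t) 0).comp t (hs.x₁_dot t ht)
    have h2 := ((hs.p₁_dot t ht).fun_pow 2).fun_add ((hq₂ t ht).fun_pow 2)
    refine (h2.fun_mul h1).congr_deriv ?_
    -- The level is taken at the instant `t`, since its constancy is what is being proved.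
    obtain ⟨h3, -, h4⟩ := deriv_hamiltonian_of_level ha hb (x₂ := y₂ t)
      (Real.sqrt_pos.mpr (mul_pos hN hD)) hp (Real.sq_sqrt (mul_pos hN hD).le).symm
    rw [h3, h4]
    set E := √((q₁ t ^ 2 + q₂ t ^ 2) * depth a b (y₁ t) 0) with hEdef
    have hE : 0 < E := Real.sqrt_pos.mpr (mul_pos hN hD)
    have hE2 : E ^ 2 = (q₁ t ^ 2 + q₂ t ^ 2) * depth a b (y₁ t) 0 :=
      Real.sq_sqrt (mul_pos hN hD).le
    have hA : (y₁ t) ^ 2 + a ≠ 0 := by positivity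
    simp only [Function.comp]
    push_cast
    field_simp
    linear_combination -(2 * q₁ t * (a - b) * y₁ t) * hE2
  intro t ht
  have c1 := hI.is_const_of_deriv_eq_zero hI'
    (fun t ht ↦ (hq₂ t ht).differentiableAt.differentiableWithinAt)
    (fun t ht ↦ (hq₂ t ht).deriv) ht h0
  have c2 := hI.is_const_of_deriv_eq_zero hI'
    (fun t ht ↦ (hH t ht).differentiableAt.differentiableWithinAt)
    (fun t ht ↦ (hH t ht).deriv) ht h0
  obtain ⟨i1, -, i3, i4⟩ := hi
  refine ⟨c1.trans i4, c2.trans ?_⟩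
  simp only [i1, i3, i4, Real.cos_sq_add_sin_sq, one_mul, depth, neg_sq]

/-- The first coordinate of a solution satisfies `ẍ = ½ (D - κ D²)'(x)`. -/
lemma IsSolutionOn.planar (ha : 0 < a) (hb : 0 < b) {ξ ψ : ℝ} {I : Set ℝ} (hI : IsOpen I)
    (hI' : IsPreconnected I) (h0 : 0 ∈ I) {y₁ y₂ q₁ q₂ : ℝ → ℝ}
    (hs : IsSolutionOn a b I y₁ y₂ q₁ q₂) (hi : HasInitialData ξ ψ y₁ y₂ q₁ q₂) :
    ∀ t ∈ I, HasDerivAt y₁ (q₁ t * depth a b (y₁ t) 0 / √(depth a b ξ 0)) t ∧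
      HasDerivAt y₂ (Real.sin ψ * depth a b (y₁ t) 0 / √(depth a b ξ 0)) t ∧
      HasDerivAt (fun t ↦ q₁ t * depth a b (y₁ t) 0 / √(depth a b ξ 0))
        (acceleration a b (Real.sin ψ ^ 2 / depth a b ξ 0) (y₁ t)) t := by
  intro t ht
  obtain ⟨c1, c2⟩ := hs.conservation ha hb hI hI' h0 hi t ht
  have hξ := depth_pos ha hb ξ 0
  have hD := depth_pos ha hb (y₁ t) 0
  set E := √(depth a b ξ 0) with hEdef
  have hE : 0 < E := Real.sqrt_pos.mpr hξ
  have hE2 : E ^ 2 = depth a b ξ 0 := Real.sq_sqrt hξ.le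
  have hp := hs.momentum_ne_zero t ht
  obtain ⟨h1, h2, h3⟩ := deriv_hamiltonian_of_level ha hb (x₂ := y₂ t) hE hp (c2.trans hE2.symm)
  have hy₁ := (hs.x₁_dot t ht).congr_deriv h1
  have hq₁ := (hs.p₁_dot t ht).congr_deriv (congr_arg Neg.neg h3)
  refine ⟨hy₁, c1 ▸ (hs.x₂_dot t ht).congr_deriv h2, ?_⟩
  refine ((hq₁.fun_mul ((hasDerivAt_depth ha b (y₁ t) 0).comp t hy₁)).div_const E).congr_deriv ?_
  have hA : (y₁ t) ^ 2 + a ≠ 0 := by positivity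
  rw [c1, ← hE2] at c2
  rw [acceleration, ← hE2]
  simp only [Function.comp]
  field_simp
  linear_combination 2 * (a - b) * y₁ t * c2

/-- The solution of the Hamiltonian system built from a solution of the planar system. -/
lemma isSolutionOn_of_planar (ha : 0 < a) (hb : 0 < b) {s E : ℝ} (hE : 0 < E) {x v x₂ : ℝ → ℝ}
    (hx : ∀ t, HasDerivAt x (v t) t)
    (hv : ∀ t, HasDerivAt v (acceleration a b (s ^ 2 / E ^ 2) (x t)) t)
    (hx₂ : ∀ t, HasDerivAt x₂ (s * depth a b (x t) 0 / E) t)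
    (hen : ∀ t, v t ^ 2 = depth a b (x t) 0 - s ^ 2 / E ^ 2 * depth a b (x t) 0 ^ 2) :
    IsSolutionOn a b Set.univ x x₂ (fun t ↦ E * v t / depth a b (x t) 0) fun _ ↦ s := by
  have hD (t : ℝ) := depth_pos ha hb (x t) 0
  have hlev (t : ℝ) :
      ((E * v t / depth a b (x t) 0) ^ 2 + s ^ 2) * depth a b (x t) 0 = E ^ 2 := by
    have := (hD t).ne'
    rw [div_pow, mul_pow, hen t]
    field_simp
    ring
  have hp (t : ℝ) : ¬ (E * v t / depth a b (x t) 0 = 0 ∧ s = 0) := by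
    rintro ⟨h1, h2⟩
    have := hlev t
    rw [h1, h2] at this
    have : 0 < E ^ 2 := by positivity
    simp_all
  have hd (t : ℝ) := deriv_hamiltonian_of_level ha hb (x₂ := x₂ t) hE (hp t) (hlev t)
  refine ⟨fun t _ ↦ hp t, fun t _ ↦ (hx t).congr_deriv ?_, fun t _ ↦ (hx₂ t).congr_deriv ?_,
    fun t _ ↦ ?_, fun t _ ↦ ?_⟩
  · have := (hD t).ne'
    rw [(hd t).1]
    field_simp
  · rw [(hd t).2.1]
  · have hA : (x t) ^ 2 + a ≠ 0 := by positivity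
    have hD' := (hD t).ne'
    refine (((hv t).const_mul E).fun_div
      ((hasDerivAt_depth ha b (x t) 0).comp t (hx t)) hD').congr_deriv ?_
    rw [(hd t).2.2, acceleration]
    simp only [Function.comp]
    have := hen t
    field_simp at this ⊢
    linear_combination -2 * (a - b) * x t * this
  · rw [deriv_hamiltonian_x₂, neg_zero]
    exact hasDerivAt_const t s

end Hamiltonian

/-! ### `℘` along a curve, and uniqueness of branches -/

/-- If `p` avoids the lattice at time `0`, and `(Y, Z)` solves along `p` the differential equations
of `(℘, ℘')` with the same initial values, then `p` always avoids the lattice and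
`(℘ ∘ p, ℘' ∘ p) = (Y, Z)`. -/
theorem weierstrassP_comp_eq (L : PeriodPair) {p Y Z w : ℝ → ℂ} (hw : Continuous w)
    (hp : ∀ t, HasDerivAt p (w t) t) (hY : ∀ t, HasDerivAt Y (w t * Z t) t)
    (hZ : ∀ t, HasDerivAt Z (w t * (6 * Y t ^ 2 - L.g₂ / 2)) t)
    (h0 : p 0 ∉ L.lattice) (hY0 : L.weierstrassP (p 0) = Y 0)
    (hZ0 : L.derivWeierstrassP (p 0) = Z 0) (t : ℝ) :
    p t ∉ L.lattice ∧ L.weierstrassP (p t) = Y t ∧ L.derivWeierstrassP (p t) = Z t := by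
  have hpc : Continuous p := continuous_iff_continuousAt.mpr fun t ↦ (hp t).continuousAt
  have hYc : Continuous Y := continuous_iff_continuousAt.mpr fun t ↦ (hY t).continuousAt
  have hZc : Continuous Z := continuous_iff_continuousAt.mpr fun t ↦ (hZ t).continuousAt
  have hev : ∀ t₀, p t₀ ∉ L.lattice → ∀ᶠ t in 𝓝 t₀, p t ∉ L.lattice := fun t₀ h ↦
    hpc.continuousAt.eventually (L.isClosed_lattice.isOpen_compl.mem_nhds h)
  have hP : ∀ t, p t ∉ L.lattice →
      HasDerivAt (fun t ↦ L.weierstrassP (p t)) (w t * L.derivWeierstrassP (p t)) t := fun t h ↦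
    (L.hasDerivAt_weierstrassP h).scomp t (hp t)
  have hP' : ∀ t, p t ∉ L.lattice → HasDerivAt (fun t ↦ L.derivWeierstrassP (p t))
      (w t * (6 * L.weierstrassP (p t) ^ 2 - L.g₂ / 2)) t := fun t h ↦
    (L.hasDerivAt_derivWeierstrassP h).scomp t (hp t)
  let S : Set ℝ :=
    {t | p t ∉ L.lattice ∧ L.weierstrassP (p t) = Y t ∧ L.derivWeierstrassP (p t) = Z t}
  suffices hS : S = Set.univ from (hS ▸ Set.mem_univ t : t ∈ S)
  -- Openness is local uniqueness for the differential equations.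
  have hopen : IsOpen S := by
    refine isOpen_iff_mem_nhds.mpr fun t₀ ht₀ ↦ ?_
    let F : ℂ × ℂ → ℂ × ℂ := fun q ↦ (q.2, 6 * q.1 ^ 2 - L.g₂ / 2)
    have hF : ContDiff ℝ 1 F := by fun_prop
    obtain ⟨K, U, hU, hK⟩ := hF.contDiffAt.exists_lipschitzOnWith (x := (Y t₀, Z t₀))
    have hlip : ∀ᶠ t in 𝓝 t₀, LipschitzOnWith ((‖w t₀‖₊ + 1) * K) (fun q ↦ w t • F q) U := by
      have : ∀ᶠ t in 𝓝 t₀, ‖w t‖₊ < ‖w t₀‖₊ + 1 :=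
        hw.nnnorm.continuousAt.eventually (gt_mem_nhds (lt_add_one _))
      filter_upwards [this] with t ht
      refine LipschitzOnWith.of_dist_le_mul fun q hq r hr ↦ ?_
      rw [dist_smul₀, NNReal.coe_mul, mul_assoc]
      exact mul_le_mul (by exact_mod_cast ht.le) (hK.dist_le_mul q hq r hr) dist_nonneg
        (NNReal.coe_nonneg _)
    have hPc := (hP t₀ ht₀.1).continuousAt.prodMk (hP' t₀ ht₀.1).continuousAt
    have hYZ := (hYc.prodMk hZc).continuousAt (x := t₀)
    have heq := ODE_solution_unique_of_eventually (v := fun t q ↦ w t • F q) (s := fun _ ↦ U) hlip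
      (f := fun t ↦ (L.weierstrassP (p t), L.derivWeierstrassP (p t))) (g := fun t ↦ (Y t, Z t))
      (by
        filter_upwards [hev t₀ ht₀.1, hPc.eventually_mem (by
          simpa [ht₀.2.1, ht₀.2.2] using hU)] with t h1 h2
        exact ⟨(hP t h1).prodMk (hP' t h1), h2⟩)
      (by
        filter_upwards [hYZ.eventually_mem hU] with t h2
        exact ⟨(hY t).prodMk (hZ t), h2⟩)
      (by simp [ht₀.2.1, ht₀.2.2])
    filter_upwards [heq, hev t₀ ht₀.1] with t h1 h2
    exact ⟨h2, (Prod.mk.inj h1).1, (Prod.mk.inj h1).2⟩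
  have hclosed : IsClosed S := by
    refine isClosed_of_closure_subset fun t₀ ht₀ ↦ ?_
    have hne : (𝓝[S] t₀).NeBot := mem_closure_iff_nhdsWithin_neBot.mp ht₀
    have hYlim : Tendsto (fun t ↦ L.weierstrassP (p t)) (𝓝[S] t₀) (𝓝 (Y t₀)) :=
      (hYc.continuousAt.mono_left nhdsWithin_le_nhds).congr'
        (eventually_nhdsWithin_of_forall fun t ht ↦ ht.2.1.symm)
    have hZlim : Tendsto (fun t ↦ L.derivWeierstrassP (p t)) (𝓝[S] t₀) (𝓝 (Z t₀)) :=
      (hZc.continuousAt.mono_left nhdsWithin_le_nhds).congr'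
        (eventually_nhdsWithin_of_forall fun t ht ↦ ht.2.2.symm)
    -- At a lattice point `℘ ∘ p` would blow up, whereas its limit within `S` is the finite value `Y
    -- t₀`.
    have hnot : p t₀ ∉ L.lattice := by
      intro hmem
      have hlim : Tendsto p (𝓝[S] t₀) (𝓝[≠] (p t₀)) :=
        tendsto_nhdsWithin_iff.mpr ⟨hpc.continuousAt.mono_left nhdsWithin_le_nhds,
          eventually_nhdsWithin_of_forall fun t ht heq ↦ ht.1 (by rw [heq]; exact hmem)⟩
      exact not_tendsto_nhds_of_tendsto_atTop
        (tendsto_norm_cobounded_atTop.comp ((L.tendsto_weierstrassP_cobounded hmem).comp hlim)) _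
        hYlim.norm
    exact ⟨hnot,
      tendsto_nhds_unique ((hP t₀ hnot).continuousAt.mono_left nhdsWithin_le_nhds) hYlim,
      tendsto_nhds_unique ((hP' t₀ hnot).continuousAt.mono_left nhdsWithin_le_nhds) hZlim⟩
  exact IsClopen.eq_univ ⟨hclosed, hopen⟩ ⟨0, h0, hY0, hZ0⟩

/-- Uniqueness of continuous lifts along a map with invertible derivative. -/
lemma eq_of_comp_eq_of_hasStrictDerivAt {F : ℂ → ℂ} {p q : ℝ → ℂ} (hp : Continuous p)
    (hq : Continuous q) (h0 : q 0 = p 0) (hF : ∀ t, F (q t) = F (p t))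
    (hd : ∀ t, ∃ F', F' ≠ 0 ∧ HasStrictDerivAt F F' (p t)) : q = p := by
  have hclosed : IsClosed {t | q t = p t} := isClosed_eq hq hp
  have hopen : IsOpen {t | q t = p t} := by
    refine isOpen_iff_mem_nhds.mpr fun t₀ (ht₀ : q t₀ = p t₀) ↦ ?_
    obtain ⟨F', hF', hs⟩ := hd t₀
    have hinv : ∀ᶠ z in 𝓝 (p t₀), hs.localInverse F F' (p t₀) hF' (F z) = z :=
      HasStrictFDerivAt.eventually_left_inverse _
    have hq₀ : Tendsto q (𝓝 t₀) (𝓝 (p t₀)) := ht₀ ▸ hq.continuousAt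
    filter_upwards [hp.continuousAt.eventually hinv, hq₀.eventually hinv] with t h1 h2
    rw [← h1, ← h2, hF t]
  have huniv := IsClopen.eq_univ ⟨hclosed, hopen⟩ ⟨0, h0⟩
  funext t
  exact (huniv ▸ Set.mem_univ t : t ∈ {t | q t = p t})

/-- A differentiable square root of `r²` that agrees with `r ≠ 0` at time `0` is `r`, if `r` has
only simple zeros. -/
lemma eq_of_sq_eq_sq_of_deriv_ne_zero {r s : ℝ → ℝ} (hr : Differentiable ℝ r)
    (hs : Differentiable ℝ s) (hsq : ∀ t, s t ^ 2 = r t ^ 2) (h0 : s 0 = r 0) (h0' : r 0 ≠ 0)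
    (hsimple : ∀ t, r t = 0 → deriv r t ≠ 0) : s = r := by
  classical
  have hpunct : ∀ t₀, r t₀ = 0 → ∀ᶠ t in 𝓝[≠] t₀, r t ≠ 0 := fun t₀ h ↦ by
    simpa [h] using (hr t₀).hasDerivAt.eventually_ne (c := 0) (hsimple t₀ h)
  have hlim : ∀ t₀, r t₀ = 0 →
      Tendsto (fun t ↦ s t / r t) (𝓝[≠] t₀) (𝓝 (deriv s t₀ / deriv r t₀)) := by
    intro t₀ h
    have hs0 : s t₀ = 0 := by simpa [h] using hsq t₀
    have h1 := (hasDerivAt_iff_tendsto_slope.mp (hs t₀).hasDerivAt).div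
      (hasDerivAt_iff_tendsto_slope.mp (hr t₀).hasDerivAt) (hsimple t₀ h)
    refine h1.congr' (eventually_nhdsWithin_of_forall fun t ht ↦ ?_)
    have ht' : t - t₀ ≠ 0 := sub_ne_zero.mpr ht
    simp only [Pi.div_apply, slope_def_field, h, hs0, sub_zero]
    exact div_div_div_cancel_right₀ ht' _ _
  -- The quotient `s / r`, extended over the simple zeros by the ratio of derivatives, is continuous
  -- with values `±1`, hence constant.
  let u : ℝ → ℝ := fun t ↦ if r t = 0 then deriv s t / deriv r t else s t / r t
  have huc : Continuous u := by
    refine continuous_iff_continuousAt.mpr fun t₀ ↦ ?_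
    by_cases h : r t₀ = 0
    · rw [continuousAt_iff_punctured_nhds, show u t₀ = deriv s t₀ / deriv r t₀ from if_pos h]
      refine (hlim t₀ h).congr' ?_
      filter_upwards [hpunct t₀ h] with t ht
      exact (if_neg ht).symm
    · refine ((hs.continuous.continuousAt).div hr.continuous.continuousAt h).congr ?_
      filter_upwards [hr.continuous.continuousAt.eventually_ne h] with t ht
      exact (if_neg ht).symm
  have hu2 : ∀ t, u t ^ 2 = 1 := by
    intro t₀
    by_cases h : r t₀ = 0
    · rw [show u t₀ = deriv s t₀ / deriv r t₀ from if_pos h]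
      refine tendsto_nhds_unique ((hlim t₀ h).pow 2) (tendsto_const_nhds.congr' ?_)
      filter_upwards [hpunct t₀ h] with t ht
      rw [div_pow, hsq t, div_self (pow_ne_zero 2 ht)]
    · rw [show u t₀ = s t₀ / r t₀ from if_neg h, div_pow, hsq, div_self (pow_ne_zero 2 h)]
  have hu0 : u 0 = 1 := by
    rw [show u 0 = s 0 / r 0 from if_neg h0', h0, div_self h0']
  have hu1 : ∀ t, u t = 1 := by
    intro t
    by_contra hne
    have hneg : u t = -1 := (sq_eq_one_iff.mp (hu2 t)).resolve_left hne
    obtain ⟨τ, hτ⟩ := mem_range_of_exists_le_of_exists_ge huc (c := 0) ⟨t, by simp [hneg]⟩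
      ⟨0, by simp [hu0]⟩
    have := hu2 τ
    rw [hτ] at this
    norm_num at this
  funext t
  by_cases h : r t = 0
  · have := hsq t
    rw [h] at this ⊢
    simpa using this
  · have := hu1 t
    rw [show u t = s t / r t from if_neg h, div_eq_one_iff_eq h] at this
    exact this

/-! ### Identities between the constants -/

section Constants

variable {a b ξ ψ : ℝ}

lemma csqrt_sq (s : ℝ) : csqrt s ^ 2 = s := by
  simp [csqrt, Complex.sqrt]

/-- Principal roots are not multiplicative in general, but a nonnegative real factor comes out even
for `s < 0`. This relates `√(𝔥 - 1)` to `h`. -/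
lemma csqrt_sq_mul {k : ℝ} (hk : 0 ≤ k) (s : ℝ) : csqrt (k ^ 2 * s) = k * csqrt s := by
  have h1 : ‖((k ^ 2 * s : ℝ) : ℂ)‖ = k ^ 2 * ‖(s : ℂ)‖ := by
    rw [Complex.norm_real, Complex.norm_real, norm_mul, norm_pow, Real.norm_of_nonneg hk]
  have h2 (x : ℝ) : √(k ^ 2 * x) = k * √x := by
    rw [Real.sqrt_mul (sq_nonneg k), Real.sqrt_sq hk]
  rw [csqrt, csqrt, Complex.sqrt_eq_real_add_ite, Complex.sqrt_eq_real_add_ite, h1,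
    Complex.ofReal_re, Complex.ofReal_re, Complex.ofReal_im, Complex.ofReal_im, ← mul_add,
    ← mul_sub, mul_div_assoc, mul_div_assoc, h2, h2]
  push_cast
  ring

lemma csqrt_one : csqrt 1 = 1 := by simp [csqrt]

lemma rootSign_mul_abs_sin (ψ : ℝ) : rootSign ψ * |Real.sin ψ| = Real.sin ψ := by
  unfold rootSign
  split_ifs with h
  · rw [abs_of_neg h]; ring
  · rw [abs_of_nonneg (not_lt.mp h)]; ring

lemma frakh_ne_zero (hb : 0 < b) (hψ : (ξ ^ 2 + a) * Real.sin ψ ^ 2 ≠ ξ ^ 2 + b) :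
    frakh a b ξ ψ ≠ 0 :=
  div_ne_zero (by positivity) (sub_ne_zero.mpr hψ.symm)

lemma inv_frakh (ha : 0 < a) (hb : 0 < b) :
    (frakh a b ξ ψ)⁻¹ = 1 - Real.sin ψ ^ 2 / depth a b ξ 0 := by
  have h1 : ξ ^ 2 + b ≠ 0 := by positivity
  have h2 : ξ ^ 2 + a ≠ 0 := by positivity
  unfold frakh depth
  field_simp

lemma h_sq (a b ξ ψ : ℝ) : h a b ξ ψ ^ 2 = frakh a b ξ ψ := csqrt_sq _

lemma h_ne_zero (hb : 0 < b) (hψ : (ξ ^ 2 + a) * Real.sin ψ ^ 2 ≠ ξ ^ 2 + b) : h a b ξ ψ ≠ 0 := by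
  intro h0
  have := h_sq a b ξ ψ
  rw [h0, zero_pow two_ne_zero] at this
  exact frakh_ne_zero hb hψ (by exact_mod_cast this.symm)

lemma rootSign_mul_sqrt (ha : 0 < a) (hb : 0 < b) :
    rootSign ψ * √(1 - (frakh a b ξ ψ)⁻¹) = Real.sin ψ / √(depth a b ξ 0) := by
  rw [inv_frakh ha hb, sub_sub_cancel, Real.sqrt_div (sq_nonneg _), Real.sqrt_sq_eq_abs,
    ← mul_div_assoc, rootSign_mul_abs_sin]

/-- By `inv_frakh`, `𝔥 - 1 = (sin² ψ / D(ξ)) 𝔥`, and the common sign turns `|sin ψ|` into `sin ψ`.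
-/
lemma rootSign_mul_csqrt (ha : 0 < a) (hb : 0 < b)
    (hψ : (ξ ^ 2 + a) * Real.sin ψ ^ 2 ≠ ξ ^ 2 + b) :
    (rootSign ψ : ℂ) * csqrt (frakh a b ξ ψ - 1) =
      ((Real.sin ψ / √(depth a b ξ 0) : ℝ) : ℂ) * h a b ξ ψ := by
  have hD := depth_pos ha hb ξ 0
  have h1 : frakh a b ξ ψ - 1 = (|Real.sin ψ| / √(depth a b ξ 0)) ^ 2 * frakh a b ξ ψ := by
    have h2 := inv_frakh (ξ := ξ) (ψ := ψ) ha hb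
    have h3 := frakh_ne_zero hb hψ
    rw [div_pow, sq_abs, Real.sq_sqrt hD.le]
    have h4 : (frakh a b ξ ψ)⁻¹ * frakh a b ξ ψ = 1 := inv_mul_cancel₀ h3
    rw [h2] at h4
    linear_combination h4
  rw [h1, csqrt_sq_mul (by positivity), ← mul_assoc, h, ← Complex.ofReal_mul, ← mul_div_assoc,
    rootSign_mul_abs_sin]

lemma momentumCoeff_eq (ha : 0 < a) (hb : 0 < b)
    (hψ : (ξ ^ 2 + a) * Real.sin ψ ^ 2 ≠ ξ ^ 2 + b) :
    momentumCoeff a b ξ ψ = (√(depth a b ξ 0) : ℂ) / h a b ξ ψ := by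
  have hE : (√(depth a b ξ 0) : ℂ) ≠ 0 := by
    exact_mod_cast (Real.sqrt_pos.mpr (depth_pos ha hb ξ 0)).ne'
  unfold momentumCoeff
  split_ifs with hs
  · have : frakh a b ξ ψ = 1 := by
      have h1 : ξ ^ 2 + b ≠ 0 := by positivity
      simp [frakh, hs, h1]
    rw [h, this, csqrt_one, div_one]
    rfl
  · have hs' : (Real.sin ψ : ℂ) ≠ 0 := by exact_mod_cast hs
    have hh := h_ne_zero hb hψ
    rw [rootSign_mul_csqrt ha hb hψ]
    push_cast
    push_cast at hs'
    field_simp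

/-- The discriminant of the cubic with the roots that correspond to `x₁² = 0`, `-b` and
`(b - a) 𝔥 - b`. -/
lemma discriminant_eq (a b ξ ψ : ℝ) : alpha a b ξ ψ ^ 3 - 27 * beta a b ξ ψ ^ 2 =
    16 * (b * ((b - a) * frakh a b ξ ψ) * (b - (b - a) * frakh a b ξ ψ)) ^ 2 := by
  unfold alpha beta
  ring

lemma discriminant_ne_zero (hb : 0 < b) (hab : b < a) (hξ : 0 < ξ)
    (hψ : (ξ ^ 2 + a) * Real.sin ψ ^ 2 ≠ ξ ^ 2 + b) :
    alpha a b ξ ψ ^ 3 ≠ 27 * beta a b ξ ψ ^ 2 := by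
  rw [← sub_ne_zero, discriminant_eq]
  have hden : ξ ^ 2 + b - (ξ ^ 2 + a) * Real.sin ψ ^ 2 ≠ 0 := sub_ne_zero.mpr hψ.symm
  -- Equality would give `a (ξ² + b) ≤ b (ξ² + a)`, against `b < a` and `ξ > 0`.
  have h3 : b - (b - a) * frakh a b ξ ψ ≠ 0 := by
    intro h0
    have h1 : a * (ξ ^ 2 + b) = b * (ξ ^ 2 + a) * Real.sin ψ ^ 2 := by
      unfold frakh at h0
      field_simp at h0
      linear_combination h0
    have h2 : b * (ξ ^ 2 + a) * Real.sin ψ ^ 2 ≤ b * (ξ ^ 2 + a) * 1 := by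
      have := hb.trans hab
      gcongr
      exact Real.sin_sq_le_one ψ
    nlinarith [pow_pos hξ 2]
  have h2 : (b - a) * frakh a b ξ ψ ≠ 0 :=
    mul_ne_zero (sub_ne_zero.mpr hab.ne) (frakh_ne_zero hb hψ)
  exact mul_ne_zero (by norm_num) (pow_ne_zero 2 (mul_ne_zero (mul_ne_zero hb.ne' h2) h3))

end Constants

theorem exists_hasInvariants {a b ξ ψ : ℝ} (hb : 0 < b) (hab : b < a) (hξ : 0 < ξ)
    (hψ : (ξ ^ 2 + a) * Real.sin ψ ^ 2 ≠ ξ ^ 2 + b) :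
    ∃ L : PeriodPair, HasInvariants L (alpha a b ξ ψ) (beta a b ξ ψ) :=
  exists_periodPair_of_discriminant_ne_zero (by exact_mod_cast discriminant_ne_zero hb hab hξ hψ)

/-- `℘` is onto and even while `℘'` is odd, so `z` or `-z` has the required sign. -/
theorem exists_isInitialPhase (a b ξ ψ : ℝ) (L : PeriodPair) :
    ∃ p₀ : ℂ, IsInitialPhase a b ξ ψ L p₀ := by
  obtain ⟨z, hz, hzP⟩ := L.exists_weierstrassP_eq ((ξ ^ 2 - delta a b ξ ψ + a : ℝ) : ℂ)
  rcases le_total ((L.derivWeierstrassP z / h a b ξ ψ).re * Real.cos ψ) 0 with hle | hle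
  · exact ⟨z, hz, hzP, hle⟩
  · refine ⟨-z, fun hmem ↦ hz (by simpa using L.lattice.neg_mem hmem), by simpa using hzP, ?_⟩
    rw [L.derivWeierstrassP_neg, neg_div, Complex.neg_re]
    linarith

/-- The value of `℘'` at an initial phase. -/
lemma IsInitialPhase.derivWeierstrassP_eq {a b ξ ψ : ℝ} (hb : 0 < b) (ha : 0 < a) (hξ : 0 < ξ)
    (hψ : (ξ ^ 2 + a) * Real.sin ψ ^ 2 ≠ ξ ^ 2 + b) {L : PeriodPair}
    (hL : HasInvariants L (alpha a b ξ ψ) (beta a b ξ ψ)) {p₀ : ℂ}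
    (hp₀ : IsInitialPhase a b ξ ψ L p₀) :
    L.derivWeierstrassP p₀ =
      h a b ξ ψ * ((-(2 * ξ * (√(depth a b ξ 0) * Real.cos ψ) * (ξ ^ 2 + a)) : ℝ) : ℂ) := by
  obtain ⟨hmem, hP, hsign⟩ := hp₀
  have hD := depth_pos ha hb ξ 0
  set E := √(depth a b ξ 0) with hE
  have hE0 : 0 < E := Real.sqrt_pos.mpr hD
  have hE2 : E ^ 2 = (ξ ^ 2 + b) / (ξ ^ 2 + a) := Real.sq_sqrt hD.le
  set R : ℝ := 2 * ξ * (E * Real.cos ψ) * (ξ ^ 2 + a) with hR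
  have hh := h_ne_zero hb hψ
  have hreal : 4 * (ξ ^ 2 - delta a b ξ ψ + a) ^ 3 - alpha a b ξ ψ * (ξ ^ 2 - delta a b ξ ψ + a) -
      beta a b ξ ψ = frakh a b ξ ψ * R ^ 2 := by
    have h1 : R ^ 2 = 4 * ξ ^ 2 * (ξ ^ 2 + b) * (ξ ^ 2 + a) * (1 - Real.sin ψ ^ 2) := by
      rw [← Real.cos_sq', hR, mul_pow, mul_pow, mul_pow, mul_pow, hE2]
      field_simp
      ring
    have h2 : frakh a b ξ ψ * (ξ ^ 2 + b - (ξ ^ 2 + a) * Real.sin ψ ^ 2) = ξ ^ 2 + b :=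
      div_mul_cancel₀ _ (sub_ne_zero.mpr hψ.symm)
    rw [h1]
    unfold alpha beta delta
    linear_combination -4 * ξ ^ 2 * (ξ ^ 2 + b) * h2
  have hsq : L.derivWeierstrassP p₀ ^ 2 = (h a b ξ ψ * ((-R : ℝ) : ℂ)) ^ 2 := by
    rw [L.derivWeierstrassP_sq p₀ hmem, hP, hL.1, hL.2, mul_pow, h_sq]
    have := congr_arg (fun x : ℝ ↦ (x : ℂ)) hreal
    push_cast at this ⊢
    linear_combination this
  rcases sq_eq_sq_iff_eq_or_eq_neg.mp hsq with heq | heq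
  · exact heq
  -- The sign condition excludes the other root unless `cos ψ = 0`, when `R = 0` and the two roots
  -- agree.
  · have hRcos : R * Real.cos ψ ≤ 0 := by
      have : L.derivWeierstrassP p₀ / h a b ξ ψ = ((R : ℝ) : ℂ) := by
        rw [heq]
        push_cast
        field_simp
      rwa [this, Complex.ofReal_re] at hsign
    have hcos : Real.cos ψ = 0 := by
      by_contra hne
      have : 0 < R * Real.cos ψ := by
        rw [show R * Real.cos ψ = 2 * ξ * E * (ξ ^ 2 + a) * Real.cos ψ ^ 2 by rw [hR]; ring]
        positivity
      linarith
    rw [heq, hR, hcos]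
    simp

/-! ### The phase along a trajectory -/

section Trajectory

variable {a b ξ ψ : ℝ} {x v : ℝ → ℝ}

/-- The phase `p(t) = p₀ + h⁻¹ ∫₀ᵗ ds / (x(s)² + a)`. -/
noncomputable def phaseOf (a b ξ ψ : ℝ) (p₀ : ℂ) (x : ℝ → ℝ) (t : ℝ) : ℂ :=
  p₀ + (h a b ξ ψ)⁻¹ * ((∫ s in (0 : ℝ)..t, (x s ^ 2 + a)⁻¹ : ℝ) : ℂ)

lemma continuous_inv_sq_add (ha : 0 < a) (hx : Continuous x) :
    Continuous fun s ↦ (x s ^ 2 + a)⁻¹ :=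
  (by fun_prop : Continuous fun s ↦ x s ^ 2 + a).inv₀ fun s ↦ by positivity

lemma hasDerivAt_phaseOf (ha : 0 < a) (p₀ : ℂ) (hx : Continuous x) (t : ℝ) :
    HasDerivAt (phaseOf a b ξ ψ p₀ x)
      ((h a b ξ ψ)⁻¹ * (((x t ^ 2 + a)⁻¹ : ℝ) : ℂ)) t :=
  (((continuous_inv_sq_add ha hx).integral_hasStrictDerivAt 0 t).hasDerivAt.ofReal_comp.const_mul
    _).const_add p₀

lemma phaseOf_zero (p₀ : ℂ) : phaseOf a b ξ ψ p₀ x 0 = p₀ := by simp [phaseOf]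

/-- Along a trajectory, `℘(p) = x² - δ + a` and `℘'(p) = 2 h x ẋ (x² + a)`. -/
theorem weierstrassP_phaseOf (ha : 0 < a) (hb : 0 < b) (hξ : 0 < ξ)
    (hψ : (ξ ^ 2 + a) * Real.sin ψ ^ 2 ≠ ξ ^ 2 + b) {L : PeriodPair}
    (hL : HasInvariants L (alpha a b ξ ψ) (beta a b ξ ψ)) {p₀ : ℂ}
    (hp₀ : IsInitialPhase a b ξ ψ L p₀)
    (hx : ∀ t, HasDerivAt x (v t) t)
    (hv : ∀ t, HasDerivAt v (acceleration a b (Real.sin ψ ^ 2 / depth a b ξ 0) (x t)) t)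
    (hen : ∀ t, v t ^ 2 = depth a b (x t) 0 -
      Real.sin ψ ^ 2 / depth a b ξ 0 * depth a b (x t) 0 ^ 2)
    (hx0 : x 0 = -ξ) (hv0 : v 0 = √(depth a b ξ 0) * Real.cos ψ) (t : ℝ) :
    phaseOf a b ξ ψ p₀ x t ∉ L.lattice ∧
    L.weierstrassP (phaseOf a b ξ ψ p₀ x t) = ((x t ^ 2 - delta a b ξ ψ + a : ℝ) : ℂ) ∧
    L.derivWeierstrassP (phaseOf a b ξ ψ p₀ x t) =
      h a b ξ ψ * ((2 * x t * v t * (x t ^ 2 + a) : ℝ) : ℂ) := by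
  have hxc : Continuous x := continuous_iff_continuousAt.mpr fun t ↦ (hx t).continuousAt
  have hh := h_ne_zero hb hψ
  have hf := frakh_ne_zero hb hψ
  have hκ : Real.sin ψ ^ 2 / depth a b ξ 0 = 1 - (frakh a b ξ ψ)⁻¹ := by
    rw [inv_frakh ha hb]; ring
  refine weierstrassP_comp_eq L
    (Y := fun t ↦ ((x t ^ 2 - delta a b ξ ψ + a : ℝ) : ℂ))
    (Z := fun t ↦ h a b ξ ψ * ((2 * x t * v t * (x t ^ 2 + a) : ℝ) : ℂ))
    (w := fun t ↦ (h a b ξ ψ)⁻¹ * (((x t ^ 2 + a)⁻¹ : ℝ) : ℂ))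
    (continuous_const.mul (Complex.continuous_ofReal.comp (continuous_inv_sq_add ha hxc)))
    (hasDerivAt_phaseOf ha p₀ hxc) (fun t ↦ ?_) (fun t ↦ ?_) ?_ ?_ ?_ t
  · have hA : x t ^ 2 + a ≠ 0 := by positivity
    refine ((((hx t).fun_pow 2).sub_const _).add_const a).ofReal_comp.congr_deriv ?_
    rw [mul_mul_mul_comm, inv_mul_cancel₀ hh, one_mul, ← Complex.ofReal_mul]
    congr 1
    push_cast
    field_simp
  · have hA : x t ^ 2 + a ≠ 0 := by positivity
    have hd := (((hx t).const_mul 2).fun_mul (hv t)).fun_mul (((hx t).fun_pow 2).add_const a)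
    refine (hd.ofReal_comp.const_mul (h a b ξ ψ)).congr_deriv ?_
    -- This is `℘'' = 6℘² - g₂/2` in real form: `𝔥 = h²`, and energy conservation eliminates `v²`.
    have hreal : frakh a b ξ ψ * ((2 * v t * v t + 2 * x t *
        acceleration a b (Real.sin ψ ^ 2 / depth a b ξ 0) (x t)) * (x t ^ 2 + a) +
        2 * x t * v t * (2 * x t * v t)) * (x t ^ 2 + a) =
        6 * (x t ^ 2 - delta a b ξ ψ + a) ^ 2 - alpha a b ξ ψ / 2 := by
      have h1 : v t * v t = depth a b (x t) 0 -
          (1 - (frakh a b ξ ψ)⁻¹) * depth a b (x t) 0 ^ 2 := by rw [← sq, hen, hκ]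
      rw [show 2 * x t * v t * (2 * x t * v t) = 4 * x t ^ 2 * (v t * v t) by ring,
        show 2 * v t * v t = 2 * (v t * v t) by ring, h1, hκ, acceleration]
      unfold depth delta alpha
      generalize frakh a b ξ ψ = f at hf ⊢
      field_simp
      ring
    have hc := congr_arg (fun x : ℝ ↦ (x : ℂ)) hreal
    rw [hL.1]
    have hA' : (x t : ℂ) ^ 2 + a ≠ 0 := by exact_mod_cast hA
    push_cast at hc ⊢
    rw [← h_sq] at hc
    field_simp
    field_simp at hc
    linear_combination hc
  · simpa [phaseOf_zero] using hp₀.1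
  · rw [phaseOf_zero, hp₀.2.1, hx0, neg_sq]
  · rw [phaseOf_zero, hp₀.derivWeierstrassP_eq hb ha hξ hψ hL, hx0, hv0]
    congr 2
    ring

/-- The right side of the phase equation has derivative `(δ + ℘(p)) p' = (x² + a) / (h (x² + a)) =
1/h`. -/
lemma isPhase_phaseOf (ha : 0 < a) (hb : 0 < b)
    (hψ : (ξ ^ 2 + a) * Real.sin ψ ^ 2 ≠ ξ ^ 2 + b) {L : PeriodPair} {p₀ : ℂ} (hx : Continuous x)
    (hmem : ∀ t, phaseOf a b ξ ψ p₀ x t ∉ L.lattice)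
    (hP : ∀ t, L.weierstrassP (phaseOf a b ξ ψ p₀ x t) =
      ((x t ^ 2 - delta a b ξ ψ + a : ℝ) : ℂ)) :
    IsPhase a b ξ ψ L p₀ (phaseOf a b ξ ψ p₀ x) := by
  have hh := h_ne_zero hb hψ
  have hd := hasDerivAt_phaseOf (b := b) (ξ := ξ) (ψ := ψ) ha p₀ hx
  refine ⟨continuous_iff_continuousAt.mpr fun t ↦ (hd t).continuousAt, phaseOf_zero p₀, hmem,
    fun t ↦ ?_⟩
  let f : ℝ → ℂ := fun t ↦ (t : ℂ) / h a b ξ ψ - ((delta a b ξ ψ : ℂ) *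
    (phaseOf a b ξ ψ p₀ x t - p₀) - weierstrassZeta L (phaseOf a b ξ ψ p₀ x t))
  have hf (t : ℝ) : HasDerivAt f 0 t := by
    have h1 := (Complex.ofRealCLM.hasDerivAt (x := t)).div_const (h a b ξ ψ)
    have h2 := ((hd t).sub_const p₀).const_mul (delta a b ξ ψ : ℂ)
    have h3 := (hasDerivAt_weierstrassZeta L (hmem t)).scomp t (hd t)
    refine (h1.fun_sub (h2.fun_sub h3)).congr_deriv ?_
    have hA : (x t : ℂ) ^ 2 + a ≠ 0 := by
      exact_mod_cast (by positivity : (0 : ℝ) < x t ^ 2 + a).ne'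
    rw [hP t, smul_eq_mul]
    simp only [Complex.ofRealCLM_apply]
    push_cast
    field_simp
    ring
  have hconst := is_const_of_deriv_eq_zero (fun t ↦ (hf t).differentiableAt)
    (fun t ↦ (hf t).deriv) t 0
  simp only [f, phaseOf_zero, sub_self, mul_zero, Complex.ofReal_zero, zero_div, zero_sub,
    sub_neg_eq_add, zero_add] at hconst
  linear_combination hconst

/-- Two phases are lifts of the same path along `z ↦ δ z - ζ(z)`, whose derivative is `δ + ℘`. -/
lemma IsPhase.eq_of_weierstrassP_ne {L : PeriodPair} {p₀ : ℂ} {p q : ℝ → ℂ}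
    (hp : IsPhase a b ξ ψ L p₀ p) (hq : IsPhase a b ξ ψ L p₀ q)
    (hP : ∀ t, L.weierstrassP (p t) + delta a b ξ ψ ≠ 0) : q = p := by
  refine eq_of_comp_eq_of_hasStrictDerivAt
    (F := fun z ↦ (delta a b ξ ψ : ℂ) * z - weierstrassZeta L z) hp.continuous hq.continuous
    (hq.initial.trans hp.initial.symm) (fun t ↦ ?_) fun t ↦ ⟨_, hP t, ?_⟩
  · linear_combination (hp.equation t) - hq.equation t
  · have hz : DifferentiableOn ℂ (weierstrassZeta L) ((L.lattice : Set ℂ)ᶜ) := fun z hz ↦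
      (hasDerivAt_weierstrassZeta L hz).differentiableAt.differentiableWithinAt
    have hs := (hz.analyticAt (L.isClosed_lattice.isOpen_compl.mem_nhds
      (hp.notMem t))).hasStrictDerivAt
    rw [(hasDerivAt_weierstrassZeta L (hp.notMem t)).deriv] at hs
    refine (((hasStrictDerivAt_id (p t)).const_mul (delta a b ξ ψ : ℂ)).sub hs).congr_deriv ?_
    ring

/-- The velocity of the first coordinate does not vanish on the ridge. -/
lemma velocity_ne_zero (hb : 0 < b) (hab : b < a) (hξ : 0 < ξ) {u : ℝ}
    (hu : u ^ 2 = depth a b 0 0 - Real.sin ψ ^ 2 / depth a b ξ 0 * depth a b 0 0 ^ 2) :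
    u ≠ 0 := by
  have ha := hb.trans hab
  rintro rfl
  have hD0 := depth_pos ha hb 0 0
  have hD := depth_pos ha hb ξ 0
  -- The depth is smaller on the ridge than at the start; zero velocity would need `sin² ψ D(0) =
  -- D(ξ)`, impossible for `sin² ψ ≤ 1`.
  have h1 : depth a b 0 0 < depth a b ξ 0 := by
    unfold depth
    rw [div_lt_div_iff₀ (by positivity) (by positivity)]
    nlinarith [pow_pos hξ 2]
  have h2 : Real.sin ψ ^ 2 * depth a b 0 0 = depth a b ξ 0 := by
    field_simp at hu
    have := mul_left_cancel₀ hD0.ne' (show depth a b 0 0 * (Real.sin ψ ^ 2 * depth a b 0 0) =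
      depth a b 0 0 * depth a b ξ 0 by linear_combination hu)
    exact this
  nlinarith [Real.sin_sq_le_one ψ]

end Trajectory

end Ridge

/-! ### Proof of the theorem -/

open Ridge in
theorem theorem2 (a b ξ ψ : ℝ) (hb : 0 < b) (hab : b < a) (hξ : 0 < ξ)
    (hψ : (ξ ^ 2 + a) * Real.sin ψ ^ 2 ≠ ξ ^ 2 + b) :
    (∃ L : PeriodPair, Ridge.HasInvariants L (Ridge.alpha a b ξ ψ) (Ridge.beta a b ξ ψ)) ∧
    ∀ L : PeriodPair, Ridge.HasInvariants L (Ridge.alpha a b ξ ψ) (Ridge.beta a b ξ ψ) →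
      (∃ p₀ : ℂ, Ridge.IsInitialPhase a b ξ ψ L p₀) ∧
      ∀ p₀ : ℂ, Ridge.IsInitialPhase a b ξ ψ L p₀ →
        ∃ (p : ℝ → ℂ) (r x₁ x₂ p₁ p₂ : ℝ → ℝ),
          -- the phase and the branch of the square root exist and are unique
          (Ridge.IsPhase a b ξ ψ L p₀ p ∧ ∀ q, Ridge.IsPhase a b ξ ψ L p₀ q → q = p) ∧
          (Ridge.IsRootBranch a b ξ ψ L p r ∧ ∀ s, Ridge.IsRootBranch a b ξ ψ L p s → s = r) ∧
          -- the solution of the Cauchy problem exists for all times and is unique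
          Ridge.IsSolutionOn a b Set.univ x₁ x₂ p₁ p₂ ∧
          Ridge.HasInitialData ξ ψ x₁ x₂ p₁ p₂ ∧
          (∀ (I : Set ℝ) (y₁ y₂ q₁ q₂ : ℝ → ℝ), IsOpen I → IsPreconnected I → 0 ∈ I →
            Ridge.IsSolutionOn a b I y₁ y₂ q₁ q₂ → Ridge.HasInitialData ξ ψ y₁ y₂ q₁ q₂ →
            ∀ t ∈ I, y₁ t = x₁ t ∧ y₂ t = x₂ t ∧ q₁ t = p₁ t ∧ q₂ t = p₂ t) ∧
          -- the explicit form of the solution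
          (∀ t, x₁ t = -r t) ∧
          (∀ t, (x₂ t : ℂ) =
            (Ridge.rootSign ψ : ℂ) * ((√(1 - (Ridge.frakh a b ξ ψ)⁻¹) : ℝ) : ℂ) * (t : ℂ) +
            (Ridge.rootSign ψ : ℂ) * Ridge.csqrt (Ridge.frakh a b ξ ψ - 1) *
              ((b : ℂ) - (a : ℂ)) * (p t - p₀)) ∧
          (∀ t, r t ≠ 0 → (p₁ t : ℂ) =
            -(1 / 2) * Ridge.momentumCoeff a b ξ ψ *
              (L.derivWeierstrassP (p t) /
                (L.weierstrassP (p t) + (Ridge.delta a b ξ ψ : ℂ) - (a : ℂ) + (b : ℂ))) *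
              (1 / (r t : ℂ))) ∧
          (∀ t, p₂ t = Real.sin ψ) := by
  have ha := hb.trans hab
  refine ⟨exists_hasInvariants hb hab hξ hψ, fun L hL ↦ ⟨exists_isInitialPhase a b ξ ψ L,
    fun p₀ hp₀ ↦ ?_⟩⟩
  have hDξ := depth_pos ha hb ξ 0
  set E := √(depth a b ξ 0) with hEdef
  have hE : 0 < E := Real.sqrt_pos.mpr hDξ
  have hE2 : E ^ 2 = depth a b ξ 0 := Real.sq_sqrt hDξ.le
  have hh := h_ne_zero hb hψ
  obtain ⟨x, v, hx0, hv0, hx, hv⟩ := exists_planar_solution ha b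
    (Real.sin ψ ^ 2 / depth a b ξ 0) (-ξ) (E * Real.cos ψ)
  have hxc : Continuous x := continuous_iff_continuousAt.mpr fun t ↦ (hx t).continuousAt
  have hen := planar_energy ha b _ hx hv (by
    have : depth a b (-ξ) 0 = depth a b ξ 0 := by simp [depth]
    rw [hx0, hv0, this, mul_pow, hE2, Real.cos_sq']
    field_simp)
  have hphase := weierstrassP_phaseOf ha hb hξ hψ hL hp₀ hx hv hen hx0 hv0
  have hP (t : ℝ) : L.weierstrassP (phaseOf a b ξ ψ p₀ x t) + (delta a b ξ ψ : ℂ) - (a : ℂ) =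
      (x t : ℂ) ^ 2 := by
    rw [(hphase t).2.1]
    push_cast
    ring
  have hisPhase := isPhase_phaseOf ha hb hψ hxc (fun t ↦ (hphase t).1) fun t ↦ (hphase t).2.1
  have hA (t : ℝ) : (x t : ℂ) ^ 2 + a ≠ 0 := by
    exact_mod_cast (by positivity : (0 : ℝ) < x t ^ 2 + a).ne'
  have hDc : Continuous fun t ↦ Real.sin ψ * depth a b (x t) 0 / E := by
    unfold depth
    exact (continuous_const.mul ((by fun_prop : Continuous fun t ↦ x t ^ 2 + b).div (by fun_prop)
      fun t ↦ by positivity)).div_const E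
  set x₂ : ℝ → ℝ := fun t ↦ ∫ s in (0 : ℝ)..t, Real.sin ψ * depth a b (x s) 0 / E with hx₂def
  have hx₂ (t : ℝ) : HasDerivAt x₂ (Real.sin ψ * depth a b (x t) 0 / E) t :=
    (hDc.integral_hasStrictDerivAt 0 t).hasDerivAt
  have hsol := isSolutionOn_of_planar ha hb hE hx (hE2 ▸ hv) hx₂ (hE2 ▸ hen)
  have hinit : HasInitialData ξ ψ x x₂ (fun t ↦ E * v t / depth a b (x t) 0)
      (fun _ ↦ Real.sin ψ) := by
    refine ⟨hx0, by simp [hx₂def], ?_, rfl⟩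
    have : depth a b (-ξ) 0 = E ^ 2 := by rw [hE2]; simp [depth]
    simp only [hx0, hv0, this]
    field_simp
  refine ⟨phaseOf a b ξ ψ p₀ x, fun t ↦ -x t, x, x₂, fun t ↦ E * v t / depth a b (x t) 0,
    fun _ ↦ Real.sin ψ, ⟨hisPhase, fun q hq ↦ hisPhase.eq_of_weierstrassP_ne hq fun t ↦ ?_⟩,
    ⟨⟨fun t ↦ (hx t).differentiableAt.neg, by simp [hx0], fun t ↦ ?_⟩, fun s hs ↦ ?_⟩, hsol, hinit,
    ?_, fun t ↦ by simp, fun t ↦ ?_, fun t ht ↦ ?_, fun _ ↦ rfl⟩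
  · rw [show L.weierstrassP (phaseOf a b ξ ψ p₀ x t) + (delta a b ξ ψ : ℂ) = (x t : ℂ) ^ 2 + a by
      linear_combination hP t]
    exact hA t
  · rw [hP t]
    push_cast
    ring
  · refine eq_of_sq_eq_sq_of_deriv_ne_zero (fun t ↦ (hx t).differentiableAt.neg) hs.differentiable
      (fun t ↦ ?_) (by simp [hs.initial, hx0]) (by simp [hx0, hξ.ne']) fun t ht ↦ ?_
    · have := (hs.sq t).trans (hP t)
      rw [neg_sq]
      exact_mod_cast this
    · have hxt : x t = 0 := neg_eq_zero.mp ht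
      rw [(hx t).fun_neg.deriv]
      exact neg_ne_zero.mpr (velocity_ne_zero hb hab hξ (by simpa [hxt] using hen t))
  · intro I y₁ y₂ q₁ q₂ hI hI' h0 hs hi
    have hpl := hs.planar ha hb hI hI' h0 hi
    simp only [← hEdef] at hpl
    have hcons := hs.conservation ha hb hI hI' h0 hi
    have huniq := planar_solution_unique ha b _ hI hI' h0 (fun t ht ↦ (hpl t ht).1)
      (fun t ht ↦ (hpl t ht).2.2) (fun t _ ↦ hx t) (fun t _ ↦ hv t) (by rw [hi.1, hx0])
      (by
        have : depth a b (-ξ) 0 = E ^ 2 := by rw [hE2]; simp [depth]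
        rw [hi.1, hi.2.2.1, hv0, this]
        field_simp)
    have hy₂ : ∀ t ∈ I, HasDerivAt (fun t ↦ y₂ t - x₂ t) 0 t := fun t ht ↦
      ((hpl t ht).2.1.fun_sub (hx₂ t)).congr_deriv (by rw [(huniq t ht).1, sub_self])
    intro t ht
    have hc := hI.is_const_of_deriv_eq_zero hI'
      (fun t ht ↦ (hy₂ t ht).differentiableAt.differentiableWithinAt)
      (fun t ht ↦ (hy₂ t ht).deriv) ht h0
    simp only [hi.2.1, hinit.2.1, sub_self] at hc
    refine ⟨(huniq t ht).1, sub_eq_zero.mp hc, ?_, (hcons t ht).1⟩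
    have hD := (depth_pos ha hb (x t) 0).ne'
    have := (huniq t ht).2
    rw [(huniq t ht).1] at this
    change q₁ t = E * v t / depth a b (x t) 0
    rw [← this]
    field_simp
  · rw [← Complex.ofReal_mul, rootSign_mul_sqrt ha hb, rootSign_mul_csqrt ha hb hψ]
    -- Splitting `D = 1 + (b - a)/(x² + a)` separates the term linear in `t` from the integral in
    -- the phase.
    have hint : x₂ t = Real.sin ψ / E * t +
        Real.sin ψ / E * (b - a) * ∫ s in (0 : ℝ)..t, (x s ^ 2 + a)⁻¹ := by
      have hi1 : IntervalIntegrable (fun _ : ℝ ↦ Real.sin ψ / E) MeasureTheory.volume 0 t :=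
        intervalIntegrable_const
      have hi2 := ((continuous_inv_sq_add ha hxc).intervalIntegrable 0 t
        (μ := MeasureTheory.volume)).const_mul (Real.sin ψ / E * (b - a))
      have hsum := intervalIntegral.integral_add hi1 hi2
      rw [intervalIntegral.integral_const_mul, intervalIntegral.integral_const] at hsum
      rw [hx₂def]
      simp only [sub_zero, smul_eq_mul] at hsum
      rw [mul_comm _ t, ← hsum]
      refine intervalIntegral.integral_congr fun s _ ↦ ?_
      simp only [depth_eq_one_add ha]
      ring
    rw [hint, phaseOf]
    push_cast
    field_simp
    ring
  · have hxt : (x t : ℂ) ≠ 0 := by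
      have : x t ≠ 0 := fun h ↦ ht (by simp [h])
      exact_mod_cast this
    have hB : (x t : ℂ) ^ 2 + b ≠ 0 := by
      exact_mod_cast (by positivity : (0 : ℝ) < x t ^ 2 + b).ne'
    have hA := hA t
    -- The coefficient `E / h` cancels the `h` in `℘' = 2 h x v (x² + a)`, and `r = -x` absorbs the
    -- minus sign, leaving `E v / D`.
    rw [momentumCoeff_eq ha hb hψ, ← hEdef, (hphase t).2.2, hP t]
    unfold depth
    push_cast
    field_simp
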